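/- A \emph{Sylvester matrix rank function} on a ring $A$ is a map $\mathrm{rk}$ assigning a non-negative real number to every (rectangular) matrix over $A$ such that: $\mathrm{rk}(0)=0$ for every zero matrix and $\mathrm{rk}(1)=1$; $\mathrm{rk}(XY)\le\min\{\mathrm{rk}(X),\mathrm{rk}(Y)\}$ whenever $XY$ is defined; $\mathrm{rk}\begin{pmatrix}X&0\\0&Y\end{pmatrix}=\mathrm{rk}(X)+\mathrm{rk}(Y)$; and $\mathrm{rk}\begin{pmatrix}X&Z\\0&Y\end{pmatrix}\ge\mathrm{rk}(X)+\mathrm{rk}(Y)$ for $X,Y,Z$ of appropriate sizes. Let $\mathbb P(A)$ be the convex set of all such functions; an extreme point of $\mathbb P(A)$ is an element that is not a non-trivial convex combination of two different elements of $\mathbb P(A)$. A ring homomorphism $\varphi:A\to B$ induces $\varphi^\sharp:\mathbb P(B)\to\mathbb P(A)$, $\varphi^\sharp(\mathrm{rk})(X)=\mathrm{rk}(\varphi(X))$. An element of $\mathbb P(A)$ is \emph{regular} if it equals $\varphi^\sharp(\mathrm{rk}')$ for some homomorphism $\varphi:A\to\mathcal U$ to a von Neumann regular ring $\mathcal U$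 and some $\mathrm{rk}'\in\mathbb P(\mathcal U)$; $\mathbb P_{\mathrm{reg}}(A)$ is the set of regular rank functions. \textbf{Proposition.} Let $\mathcal D$ be a division ring, and let $\tau$ be an automorphism of $\mathcal D$ of finite inner order, i.e. $\tau^k$ is an inner automorphism for some integer $k\ge 1$. Let $R=\mathcal D[t^{\pm1};\tau]$ be the skew Laurent polynomial ring, with $td=\tau(d)t$ for $d\in\mathcal D$, and let $Z(R)$ be its center. Let $\mathfrak m$ be a maximal two-sided ideal of $R$ and let $n\ge1$ be an integer. Then: (1) $\mathbb P(R/\mathfrak m^n)$ has exactly $n$ extreme points; (2) $\mathbb P(R/\mathfrak m^n)=\mathbb P_{\mathrm{reg}}(R/\mathfrak m^n)$; (3) the natural map $\varphi_n:Z(R)/(\mathfrak m^n\cap Z(R))\to R/\mathfrak m^n$ is injective and induces a bijection $\varphi_n^\sharp:\mathbb P(R/\mathfrak m^n)\to\mathbb P\bigl(Z(R)/(\mathfrak m^n\cap Z(R))\bigr)$. -/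

import Mathlib

/-! ### Sylvester matrix rank functions -/

/-- Real-valued functions on the (finite, rectangular) matrices over `R`. -/
abbrev MatrixFunction (R : Type*) : Type _ :=
  ∀ m n : ℕ, Matrix (Fin m) (Fin n) R → ℝ

/-- The block matrix `(A C; 0 B)`, with rows and columns indexed by `Fin (m + p)` and
`Fin (n + q)`. -/
def upperBlock {R : Type*} [Ring R] {m n p q : ℕ} (A : Matrix (Fin m) (Fin n) R)
    (C : Matrix (Fin m) (Fin q) R) (B : Matrix (Fin p) (Fin q) R) :
    Matrix (Fin (m + p)) (Fin (n + q)) R :=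
  Matrix.reindex finSumFinEquiv finSumFinEquiv (Matrix.fromBlocks A C 0 B)

/-- `rk` is a Sylvester matrix rank function on the ring `R`. -/
structure IsSylvesterRank {R : Type*} [Ring R] (rk : MatrixFunction R) : Prop where
  nonneg : ∀ (m n : ℕ) (A : Matrix (Fin m) (Fin n) R), 0 ≤ rk m n A
  zero : ∀ m n : ℕ, rk m n 0 = 0
  one : rk 1 1 1 = 1
  mul_le : ∀ (m n p : ℕ) (A : Matrix (Fin m) (Fin n) R) (B : Matrix (Fin n) (Fin p) R),
    rk m p (A * B) ≤ min (rk m n A) (rk n p B)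
  diag : ∀ (m n p q : ℕ) (A : Matrix (Fin m) (Fin n) R) (B : Matrix (Fin p) (Fin q) R),
    rk (m + p) (n + q) (upperBlock A 0 B) = rk m n A + rk p q B
  upper : ∀ (m n p q : ℕ) (A : Matrix (Fin m) (Fin n) R) (C : Matrix (Fin m) (Fin q) R)
    (B : Matrix (Fin p) (Fin q) R),
    rk m n A + rk p q B ≤ rk (m + p) (n + q) (upperBlock A C B)

/-- The space `ℙ(R)` of Sylvester matrix rank functions on `R`, a subset of the real vector space
of real-valued functions on matrices over `R`. -/
def sylvesterRanks (R : Type*) [Ring R] : Set (MatrixFunction R) :=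
  {rk | IsSylvesterRank rk}

/-- The map `φ^♯` induced by a ring homomorphism `φ`: `φ^♯(rk)(A) = rk(φ(A))`. -/
def pullback {R S : Type*} [Ring R] [Ring S] (φ : R →+* S) (rk : MatrixFunction S) :
    MatrixFunction R :=
  fun m n A => rk m n (A.map φ)

/-- Von Neumann regular rings. -/
def IsVonNeumannRegular (U : Type*) [Ring U] : Prop :=
  ∀ x : U, ∃ y : U, x * y * x = x

/-- The space `ℙ_reg(R)` of regular rank functions: those induced by a homomorphism from `R` to
a von Neumann regular ring that carries a Sylvester rank function. -/
def regularRanks.{u} (R : Type u) [Ring R] : Set (MatrixFunction R) :=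
  {rk | ∃ (U : Type u) (_ : Ring U) (φ : R →+* U) (rk' : MatrixFunction U),
    IsVonNeumannRegular U ∧ rk' ∈ sylvesterRanks U ∧ rk = pullback φ rk'}

/-! ### Skew Laurent polynomials -/

/-- The action of the infinite cyclic group on `D` whose generator acts by `τ`. -/
abbrev zpowAction {D : Type*} [DivisionRing D] (τ : RingAut D) :
    MulSemiringAction (Multiplicative ℤ) D :=
  MulSemiringAction.compHom D (zpowersHom (RingAut D) τ)

/-- The ring `D[t^{±1}; τ]` of finite sums `∑ aᵢ tⁱ` (`i ∈ ℤ`), where `t d = τ(d) t`: the skew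
group ring of `ℤ` over `D`, where `1 ∈ ℤ` acts by `τ`. -/
def SkewLaurent {D : Type*} [DivisionRing D] (_τ : RingAut D) : Type _ :=
  SkewMonoidAlgebra D (Multiplicative ℤ)

noncomputable instance {D : Type*} [DivisionRing D] (τ : RingAut D) : Ring (SkewLaurent τ) :=
  letI := zpowAction τ
  inferInstanceAs (Ring (SkewMonoidAlgebra D (Multiplicative ℤ)))

/-- `τ` is an inner automorphism. -/
def IsInnerAut {D : Type*} [DivisionRing D] (τ : RingAut D) : Prop :=
  ∃ a : D, a ≠ 0 ∧ ∀ d : D, τ d = a⁻¹ * d * a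

/-- `τ` has finite inner order: some positive power of `τ` is inner. -/
def HasFiniteInnerOrder {D : Type*} [DivisionRing D] (τ : RingAut D) : Prop :=
  ∃ m : ℕ, 0 < m ∧ IsInnerAut (τ ^ m)

/-! ### The centre modulo a two-sided ideal -/

/-- The natural map `Z(R)/(I ∩ Z(R)) → R/I`. -/
def centerQuotientMap {R : Type*} [Ring R] (I : Ideal R) [I.IsTwoSided] :
    (Subring.center R ⧸ I.comap (Subring.center R).subtype) →+* R ⧸ I :=
  Ideal.quotientMap I (Subring.center R).subtype le_rfl

/-! A nonzero two-sided ideal of the skew Laurent ring is generated by a regular central element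
`f`: take an element of least degree spread with constant term `1`; its commutators with scalars and
with `t` have smaller spread, so they vanish. Finite inner order yields a central monomial `c t^k`,
and the non-invertible central element `1 - c t^k` rules out a zero maximal ideal.

Write `𝔪` for the ideal `m`. In `S = R/𝔪ⁿ` the class of `f` is thus central with `fⁿ = 0`, and
`S/fS` is a matrix ring of some size `r` over a division ring. Modulo `f`, the sum of `r` copies of
a matrix splits off an identity block with zero complement, so over `S` it is equivalent to an
identity block plus `f • Y`. Iterating, a rank function is determined by the numbers `rk(f^i)`
(`rank_ext`). These form a convex sequence with value `1` at `0` and value `0` from `n` on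
(`eltRank_convex`), so it is a unique convex combination of the `n` hinge sequences `max(0, 1 -
i/(j+1))`, `j < n`. Each hinge is realized by normalized dimension on `R/𝔪^(j+1)` (`exists_vertex`),
which is a regular rank function. Hence the space is a simplex with `n` regular vertices, and
regular rank functions form a convex set.

The centre modulo `𝔪ⁿ ∩ Z(R)` has the same structure with the same `f`: its quotient by `f` is the
field `Z(R)/(𝔪 ∩ Z(R))`. Rank functions on both sides are therefore described by the same sequences,
which gives the bijection (`bijOn_pullback`). -/

/-! ### Monomials and coefficients in the skew Laurent ring. -/

namespace SkewLaurent

variable {D : Type*} [DivisionRing D] {τ : RingAut D}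

/-- The monomial `a tⁱ`. -/
noncomputable def mono (τ : RingAut D) (i : ℤ) (a : D) : SkewLaurent τ :=
  (SkewMonoidAlgebra.single (Multiplicative.ofAdd i) a : SkewMonoidAlgebra D (Multiplicative ℤ))

/-- The coefficient of `tⁱ`. -/
def coeff (x : SkewLaurent τ) (i : ℤ) : D :=
  SkewMonoidAlgebra.coeff (G := Multiplicative ℤ) x (Multiplicative.ofAdd i)

theorem ext {x y : SkewLaurent τ} (h : ∀ i, coeff x i = coeff y i) : x = y :=
  SkewMonoidAlgebra.ext (G := Multiplicative ℤ) fun a => h a.toAdd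

@[simp] theorem coeff_zero (i : ℤ) : coeff (0 : SkewLaurent τ) i = 0 := rfl

@[simp] theorem coeff_add (x y : SkewLaurent τ) (i : ℤ) :
    coeff (x + y) i = coeff x i + coeff y i :=
  DFunLike.congr_fun (SkewMonoidAlgebra.coeff_add (G := Multiplicative ℤ) x y)
    (Multiplicative.ofAdd i)

@[simp] theorem coeff_sub (x y : SkewLaurent τ) (i : ℤ) :
    coeff (x - y) i = coeff x i - coeff y i := by
  have h := coeff_add (x - y) y i
  rw [sub_add_cancel] at h
  rw [h, add_sub_cancel_right]

theorem coeff_sum {ι : Type*} (s : Finset ι) (g : ι → SkewLaurent τ) (i : ℤ) :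
    coeff (∑ j ∈ s, g j) i = ∑ j ∈ s, coeff (g j) i := by
  classical
  induction s using Finset.induction_on with
  | empty => simp
  | insert a s ha ih => rw [Finset.sum_insert ha, Finset.sum_insert ha, coeff_add, ih]

theorem coeff_mono (i j : ℤ) (a : D) : coeff (mono τ i a) j = if i = j then a else 0 := by
  classical
  exact (SkewMonoidAlgebra.coeff_single_apply (G := Multiplicative ℤ)
    (a := Multiplicative.ofAdd i) (a' := Multiplicative.ofAdd j) (b := a))

theorem one_eq_mono : (1 : SkewLaurent τ) = mono τ 0 1 := rfl

theorem mono_add (i : ℤ) (a b : D) : mono τ i (a + b) = mono τ i a + mono τ i b :=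
  SkewMonoidAlgebra.single_add (G := Multiplicative ℤ) _ _ _

@[simp] theorem mono_zero (i : ℤ) : mono τ i 0 = 0 :=
  SkewMonoidAlgebra.single_zero (G := Multiplicative ℤ) _

theorem coeff_mono_mul (k : ℤ) (a : D) (x : SkewLaurent τ) (i : ℤ) :
    coeff (mono τ k a * x) i = a * (τ ^ k) (coeff x (i - k)) := by
  let := zpowAction τ
  have h := SkewMonoidAlgebra.coeff_single_mul (G := Multiplicative ℤ) (k := D) a
    (Multiplicative.ofAdd k) x (Multiplicative.ofAdd i)
  rw [sub_eq_neg_add]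
  exact h

theorem coeff_mul_mono (k : ℤ) (a : D) (x : SkewLaurent τ) (i : ℤ) :
    coeff (x * mono τ k a) i = coeff x (i - k) * (τ ^ (i - k)) a := by
  let := zpowAction τ
  exact SkewMonoidAlgebra.coeff_mul_single (G := Multiplicative ℤ) (k := D) x a
    (Multiplicative.ofAdd k) (Multiplicative.ofAdd i)

theorem mono_mul_mono (i j : ℤ) (a b : D) :
    mono τ i a * mono τ j b = mono τ (i + j) (a * (τ ^ i) b) := by
  refine ext fun k => ?_
  rw [coeff_mono_mul, coeff_mono, coeff_mono]
  by_cases h : i + j = k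
  · rw [if_pos (by omega), if_pos h]
  · rw [if_neg (by omega), if_neg h, map_zero, mul_zero]

theorem exists_window (x : SkewLaurent τ) :
    ∃ a b : ℤ, ∀ i, coeff x i ≠ 0 → a ≤ i ∧ i < b := by
  obtain ⟨s, hs⟩ : ∃ s : Finset ℤ, ∀ i, coeff x i ≠ 0 → i ∈ s := by
    refine ⟨(SkewMonoidAlgebra.support (G := Multiplicative ℤ) x).image Multiplicative.toAdd,
      fun i hi => Finset.mem_image.2 ⟨Multiplicative.ofAdd i, ?_, rfl⟩⟩
    exact SkewMonoidAlgebra.mem_support_iff.2 hi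
  obtain ⟨a, ha⟩ := s.finite_toSet.bddBelow
  obtain ⟨b, hb⟩ := s.finite_toSet.bddAbove
  exact ⟨a, b + 1, fun i hi => ⟨ha (hs i hi), Int.lt_add_one_of_le (hb (hs i hi))⟩⟩

theorem eq_sum_mono {x : SkewLaurent τ} {a b : ℤ} (h : ∀ i, coeff x i ≠ 0 → a ≤ i ∧ i < b) :
    x = ∑ i ∈ Finset.Ico a b, mono τ i (coeff x i) := by
  refine ext fun j => ?_
  simp only [coeff_sum, coeff_mono]
  rw [Finset.sum_ite_eq']
  split_ifs with hj
  · rfl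
  · by_contra hne
    exact hj (Finset.mem_Ico.2 (h j hne))

@[elab_as_elim]
theorem induction {p : SkewLaurent τ → Prop} (x : SkewLaurent τ) (h0 : p 0)
    (hadd : ∀ x y, p x → p y → p (x + y)) (hmono : ∀ i a, p (mono τ i a)) : p x := by
  obtain ⟨a, b, h⟩ := exists_window x
  rw [eq_sum_mono h]
  exact Finset.sum_induction _ p hadd h0 fun i _ => hmono i _

/-- The coefficient embedding `D → D[t^{±1}; τ]`. -/
noncomputable def C (τ : RingAut D) : D →+* SkewLaurent τ where
  toFun := mono τ 0
  map_zero' := mono_zero 0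
  map_one' := rfl
  map_add' := mono_add 0
  map_mul' a b := by rw [mono_mul_mono]; simp

theorem mono_eq_C_mul (i : ℤ) (a : D) : mono τ i a = C τ a * mono τ i 1 := by
  change _ = mono τ 0 a * _
  rw [mono_mul_mono]; simp

theorem mono_mul_mono_neg (i : ℤ) : mono τ i 1 * mono τ (-i) 1 = 1 := by
  rw [mono_mul_mono, one_eq_mono]; simp

theorem mono_neg_mul_mono (i : ℤ) : mono τ (-i) 1 * mono τ i 1 = 1 := by
  rw [mono_mul_mono, one_eq_mono]; simp

/-- A subset of `D[t^{±1}; τ]` closed under the multiplications by scalars and by `t^{±1}` from the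
left and containing `1` is everything. -/
theorem addSubgroup_eq_top (M : AddSubgroup (SkewLaurent τ)) (h1 : 1 ∈ M)
    (hC : ∀ a, ∀ x ∈ M, C τ a * x ∈ M) (ht : ∀ x ∈ M, mono τ 1 1 * x ∈ M)
    (ht' : ∀ x ∈ M, mono τ (-1) 1 * x ∈ M) (x : SkewLaurent τ) : x ∈ M := by
  have key : ∀ i : ℤ, mono τ i 1 ∈ M := by
    intro i
    induction i using Int.induction_on with
    | zero => exact h1
    | succ i ih =>
      have := ht _ ih
      rwa [mono_mul_mono, map_one, mul_one, add_comm] at this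
    | pred i ih =>
      have := ht' _ ih
      rwa [mono_mul_mono, map_one, mul_one, add_comm, ← sub_eq_add_neg] at this
  refine induction x M.zero_mem (fun _ _ => M.add_mem) fun i a => ?_
  rw [mono_eq_C_mul]
  exact hC a _ (key i)

theorem mem_center_of_commute {x : SkewLaurent τ} (hC : ∀ a, C τ a * x = x * C τ a)
    (ht : mono τ 1 1 * x = x * mono τ 1 1) : x ∈ Subring.center (SkewLaurent τ) := by
  rw [Subring.mem_center_iff]
  intro g
  let M : AddSubgroup (SkewLaurent τ) :=
    { carrier := {g | g * x = x * g}
      add_mem' := fun {a b} ha hb => by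
        simp only [Set.mem_ofPred_eq] at *
        rw [add_mul, mul_add, ha, hb]
      zero_mem' := by simp
      neg_mem' := fun {a} ha => by
        simp only [Set.mem_ofPred_eq] at *
        rw [neg_mul, mul_neg, ha] }
  refine addSubgroup_eq_top M (by simp [M]) (fun a y hy => ?_) (fun y hy => ?_) (fun y hy => ?_) g
  · change C τ a * y * x = x * (C τ a * y)
    rw [mul_assoc, show y * x = x * y from hy, ← mul_assoc, hC, mul_assoc]
  · change mono τ 1 1 * y * x = x * (mono τ 1 1 * y)
    rw [mul_assoc, show y * x = x * y from hy, ← mul_assoc, ht, mul_assoc]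
  · change mono τ (-1) 1 * y * x = x * (mono τ (-1) 1 * y)
    have h2 : mono τ (-1) 1 * x = x * mono τ (-1) 1 := by
      calc mono τ (-1) 1 * x = mono τ (-1) 1 * (x * mono τ 1 1) * mono τ (-1) 1 := by
            rw [mul_assoc, mul_assoc, mono_mul_mono_neg, mul_one]
        _ = x * mono τ (-1) 1 := by
            rw [← ht, ← mul_assoc, mono_neg_mul_mono, one_mul]
    rw [mul_assoc, show y * x = x * y from hy, ← mul_assoc, h2, mul_assoc]

/-! ### Central generators of two-sided ideals and division with remainder. -/

/-- Generator of a nonzero two-sided ideal `I`: an element `f ∈ I` with terms in degrees `0, …, s`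
and constant term `1`, such that `I` has no nonzero element with terms in `s` consecutive
degrees. -/
structure IsMinimalGenerator (I : Ideal (SkewLaurent τ)) (s : ℕ) (f : SkewLaurent τ) : Prop where
  mem : f ∈ I
  constantCoeff : coeff f 0 = 1
  window : ∀ i, coeff f i ≠ 0 → 0 ≤ i ∧ i ≤ s
  eq_zero : ∀ x ∈ I, ∀ a : ℤ, (∀ i, coeff x i ≠ 0 → a ≤ i ∧ i < a + s) → x = 0

/-- Let `s` be the least spread of a nonzero element, after shifting by powers of `t`. Minimality
forces a nonzero constant term, which is scaled to `1`. Only left multiplication is used, so the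
ideal may be one-sided. -/
theorem exists_isMinimalGenerator (I : Ideal (SkewLaurent τ)) (hI : I ≠ ⊥) :
    ∃ s f, IsMinimalGenerator I s f := by
  classical
  have hex : ∃ s : ℕ, ∃ x ∈ I, x ≠ 0 ∧ ∀ i, coeff x i ≠ 0 → 0 ≤ i ∧ i ≤ (s : ℤ) := by
    obtain ⟨x, hx, hx0⟩ := Submodule.exists_mem_ne_zero_of_ne_bot hI
    obtain ⟨a, b, h⟩ := exists_window x
    refine ⟨(b - a).toNat, mono τ (-a) 1 * x, I.mul_mem_left _ hx, fun h0 => hx0 ?_, fun i hi => ?_⟩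
    · have := congrArg (mono τ a 1 * ·) h0
      simpa only [← mul_assoc, mono_mul_mono_neg, one_mul, mul_zero] using this
    · rw [coeff_mono_mul, one_mul, Ne, EmbeddingLike.map_eq_zero_iff] at hi
      have := h _ hi
      omega
  obtain ⟨x, hxI, hx0, hxw⟩ := Nat.find_spec hex
  set s := Nat.find hex with hs
  have hmin : ∀ y ∈ I, ∀ a : ℤ, (∀ i, coeff y i ≠ 0 → a ≤ i ∧ i < a + s) → y = 0 := by
    intro y hy a hw
    by_contra hy0
    have hs0 : s ≠ 0 := by
      rintro h0
      refine hy0 (ext fun i => ?_)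
      by_contra hi
      have := hw i hi
      omega
    refine Nat.find_min hex (m := s - 1) (by omega) ⟨mono τ (-a) 1 * y, I.mul_mem_left _ hy,
      fun h0 => hy0 ?_, fun i hi => ?_⟩
    · have := congrArg (mono τ a 1 * ·) h0
      simpa only [← mul_assoc, mono_mul_mono_neg, one_mul, mul_zero] using this
    · rw [coeff_mono_mul, one_mul, Ne, EmbeddingLike.map_eq_zero_iff] at hi
      have := hw _ hi
      omega
  have hc : coeff x 0 ≠ 0 := by
    intro hc
    refine hx0 (hmin x hxI 1 fun i hi => ?_)
    have h1 := hxw i hi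
    have h2 : i ≠ 0 := by rintro rfl; exact hi hc
    omega
  refine ⟨s, C τ (coeff x 0)⁻¹ * x, I.mul_mem_left _ hxI, ?_, fun i hi => ?_, hmin⟩
  · change coeff (mono τ 0 _ * x) 0 = 1
    rw [coeff_mono_mul]; simp [hc]
  · change coeff (mono τ 0 _ * x) i ≠ 0 at hi
    rw [coeff_mono_mul] at hi
    refine hxw i fun h => hi ?_
    simp [h]

namespace IsMinimalGenerator

variable {I : Ideal (SkewLaurent τ)} {s : ℕ} {f : SkewLaurent τ}

/-- An element with terms in degrees `0, …, s - 1` that commutes with everything modulo `I` is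
central. -/
theorem mem_center_of_window (hf : IsMinimalGenerator I s f) {y : SkewLaurent τ}
    (hw : ∀ i, coeff y i ≠ 0 → 0 ≤ i ∧ i < s) (hy : ∀ g, g * y - y * g ∈ I) :
    y ∈ Subring.center (SkewLaurent τ) := by
  refine mem_center_of_commute (fun a => ?_) ?_
  · refine sub_eq_zero.1 (hf.eq_zero _ (hy _) 0 fun i hi => ?_)
    change coeff (mono τ 0 a * y - y * mono τ 0 a) i ≠ 0 at hi
    rw [coeff_sub, coeff_mono_mul, coeff_mul_mono, sub_zero] at hi
    have : coeff y i ≠ 0 := fun h => hi (by simp [h])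
    simpa using hw i this
  · refine sub_eq_zero.1 (hf.eq_zero _ (hy _) 1 fun i hi => ?_)
    rw [coeff_sub, coeff_mono_mul, coeff_mul_mono] at hi
    have : coeff y (i - 1) ≠ 0 := fun h => hi (by simp [h])
    have := hw _ this
    omega

/-- Because the constant term is `1`, the lowest term cancels in the commutators with scalars and
with `t`. What remains lies in `I` and occupies only `s` consecutive degrees. -/
theorem mem_center [I.IsTwoSided] (hf : IsMinimalGenerator I s f) :
    f ∈ Subring.center (SkewLaurent τ) := by
  have hmem : ∀ g, g * f - f * g ∈ I := fun g =>
    I.sub_mem (I.mul_mem_left _ hf.mem) (I.mul_mem_right _ hf.mem)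
  refine mem_center_of_commute (fun a => ?_) ?_
  · refine sub_eq_zero.1 (hf.eq_zero _ (hmem _) 1 fun i hi => ?_)
    change coeff (mono τ 0 a * f - f * mono τ 0 a) i ≠ 0 at hi
    rw [coeff_sub, coeff_mono_mul, coeff_mul_mono, sub_zero] at hi
    have h1 : coeff f i ≠ 0 := fun h => hi (by simp [h])
    have h2 : i ≠ 0 := by
      rintro rfl
      simp [hf.constantCoeff] at hi
    have := hf.window i h1
    omega
  · refine sub_eq_zero.1 (hf.eq_zero _ (hmem _) 2 fun i hi => ?_)
    rw [coeff_sub, coeff_mono_mul, coeff_mul_mono] at hi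
    have h1 : coeff f (i - 1) ≠ 0 := fun h => hi (by simp [h])
    have h2 : i ≠ 1 := by
      rintro rfl
      simp [hf.constantCoeff] at hi
    have := hf.window _ h1
    omega

theorem coeff_ne_zero (hf : IsMinimalGenerator I s f) : coeff f s ≠ 0 := by
  intro h
  have : f = 0 := hf.eq_zero f hf.mem 0 fun i hi => by
    have := hf.window i hi
    have h2 : i ≠ s := by rintro rfl; exact hi h
    omega
  have h1 := hf.constantCoeff
  simp [this] at h1

/-- Division with remainder: the sums of a remainder and a left multiple of `f` are stable under
left multiplication by scalars, `t` and `t⁻¹`, since both extreme coefficients of `f` are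
invertible. -/
theorem exists_sub_eq_mul (hf : IsMinimalGenerator I s f) (x : SkewLaurent τ) :
    ∃ y g, (∀ i, coeff y i ≠ 0 → 0 ≤ i ∧ i < (s : ℤ)) ∧ x - y = g * f := by
  have hs := hf.coeff_ne_zero
  let M : AddSubgroup (SkewLaurent τ) :=
    { carrier := {x | ∃ y g, (∀ i, coeff y i ≠ 0 → 0 ≤ i ∧ i < (s : ℤ)) ∧ x = y + g * f}
      add_mem' := by
        rintro _ _ ⟨y, g, hy, rfl⟩ ⟨y', g', hy', rfl⟩
        refine ⟨y + y', g + g', fun i hi => ?_, by rw [add_mul]; abel⟩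
        by_cases h : coeff y i = 0
        · refine hy' i fun h' => hi (by simp [h, h'])
        · exact hy i h
      zero_mem' := ⟨0, 0, by simp, by simp⟩
      neg_mem' := by
        rintro _ ⟨y, g, hy, rfl⟩
        refine ⟨-y, -g, fun i hi => hy i fun h => hi ?_, by rw [neg_mul]; abel⟩
        rw [← zero_sub, coeff_sub, h, coeff_zero, sub_zero] }
  suffices h : x ∈ M by
    obtain ⟨y, g, hy, h⟩ := h
    exact ⟨y, g, hy, by rw [h, add_sub_cancel_left]⟩
  refine addSubgroup_eq_top M ?_ ?_ ?_ ?_ x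
  · rcases Nat.eq_zero_or_pos s with h0 | h0
    · refine ⟨0, 1, by simp, ?_⟩
      rw [zero_add, one_mul]
      refine ext fun i => ?_
      rw [one_eq_mono, coeff_mono]
      split_ifs with hi
      · rw [← hi, hf.constantCoeff]
      · by_contra hne
        have := hf.window i (Ne.symm hne)
        omega
    · refine ⟨1, 0, fun i hi => ?_, by simp⟩
      rw [one_eq_mono, coeff_mono] at hi
      split_ifs at hi with h
      · omega
      · exact absurd rfl hi
  · rintro a _ ⟨y, g, hy, rfl⟩
    refine ⟨C τ a * y, C τ a * g, fun i hi => hy i fun h => hi ?_, by rw [mul_add, mul_assoc]⟩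
    change coeff (mono τ 0 a * y) i = 0
    rw [coeff_mono_mul]; simp [h]
  · rintro _ ⟨y, g, hy, rfl⟩
    -- Multiplication by `t` can create a term of degree `s`; this `c` cancels it against the top
    -- term of `f`.
    set c : D := τ (coeff y (s - 1)) * (coeff f s)⁻¹ with hc
    refine ⟨mono τ 1 1 * y - mono τ 0 c * f, mono τ 1 1 * g + mono τ 0 c, fun i hi => ?_, ?_⟩
    · rw [coeff_sub, coeff_mono_mul, coeff_mono_mul] at hi
      have h1 : i ≠ s := by
        rintro rfl
        simp [hc, hs] at hi
      by_cases h : coeff y (i - 1) = 0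
      · have := hf.window i fun h' => hi (by simp [h, h'])
        omega
      · have := hy _ h
        omega
    · rw [add_mul, mul_add, mul_assoc]; abel
  · rintro _ ⟨y, g, hy, rfl⟩
    -- Here the offending term has degree `-1` and is cancelled by the constant term of `f`.
    set c : D := (τ ^ (-1 : ℤ)) (coeff y 0) with hc
    refine ⟨mono τ (-1) 1 * y - mono τ (-1) c * f, mono τ (-1) 1 * g + mono τ (-1) c,
      fun i hi => ?_, ?_⟩
    · rw [coeff_sub, coeff_mono_mul, coeff_mono_mul] at hi
      have h1 : i ≠ -1 := by
        rintro rfl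
        simp [hc, hf.constantCoeff] at hi
      by_cases h : coeff y (i - -1) = 0
      · have := hf.window (i - -1) fun h' => hi (by rw [h, h']; simp)
        omega
      · have := hy _ h
        omega
    · rw [add_mul, mul_add, mul_assoc]; abel

theorem exists_sub_mem (hf : IsMinimalGenerator I s f) (x : SkewLaurent τ) :
    ∃ y, (∀ i, coeff y i ≠ 0 → 0 ≤ i ∧ i < (s : ℤ)) ∧ x - y ∈ I := by
  obtain ⟨y, g, hy, h⟩ := hf.exists_sub_eq_mul x
  exact ⟨y, hy, h ▸ I.mul_mem_left _ hf.mem⟩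

theorem mem_iff (hf : IsMinimalGenerator I s f) (x : SkewLaurent τ) :
    x ∈ I ↔ ∃ g, x = g * f := by
  refine ⟨fun hx => ?_, ?_⟩
  · obtain ⟨y, g, hy, h⟩ := hf.exists_sub_eq_mul x
    have hyI : y ∈ I := by
      have : y = x - g * f := by rw [← h]; abel
      rw [this]
      exact I.sub_mem hx (I.mul_mem_left _ hf.mem)
    have hy0 : y = 0 := hf.eq_zero y hyI 0 fun i hi => by simpa using hy i hi
    exact ⟨g, by rw [← h, hy0, sub_zero]⟩
  · rintro ⟨g, rfl⟩
    exact I.mul_mem_left _ hf.mem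

/-- The remainder of `x` still commutes with everything modulo `I`, and its short window turns this
into exact commutation. -/
theorem exists_center_sub_mem [I.IsTwoSided] (hf : IsMinimalGenerator I s f) {x : SkewLaurent τ}
    (hx : ∀ g, g * x - x * g ∈ I) : ∃ z ∈ Subring.center (SkewLaurent τ), x - z ∈ I := by
  obtain ⟨y, hy, h⟩ := hf.exists_sub_mem x
  refine ⟨y, hf.mem_center_of_window hy fun g => ?_, h⟩
  have : g * y - y * g = (g * x - x * g) - (g * (x - y) - (x - y) * g) := by
    rw [mul_sub, sub_mul]; abel
  rw [this]
  exact I.sub_mem (hx g) (I.sub_mem (I.mul_mem_left _ h) (I.mul_mem_right _ h))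

/-- If the left annihilator of `f` were nonzero, it would contain some `g` in nonnegative degrees
with constant term `1`; but then `g * f` has constant term `1`. -/
theorem mul_eq_zero_iff [I.IsTwoSided] (hf : IsMinimalGenerator I s f) {x : SkewLaurent τ}
    (hx : x * f = 0) : x = 0 := by
  by_contra h0
  let J : Ideal (SkewLaurent τ) :=
    { carrier := {y | y * f = 0}
      add_mem' := fun {a b} ha hb => by
        simp only [Set.mem_ofPred_eq] at *
        rw [add_mul, ha, hb, add_zero]
      zero_mem' := by simp
      smul_mem' := fun c y hy => by
        simp only [Set.mem_ofPred_eq, smul_eq_mul] at *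
        rw [mul_assoc, hy, mul_zero] }
  have hJ : J ≠ ⊥ := fun h => h0 (by
    have : x ∈ J := hx
    rwa [h, Ideal.mem_bot] at this)
  obtain ⟨r, g, hg⟩ := exists_isMinimalGenerator J hJ
  have hgf : g * f = 0 := hg.mem
  have hc : coeff (g * f) 0 = 1 := by
    rw [eq_sum_mono (x := g) (a := 0) (b := r + 1) fun i hi => by
      have := hg.window i hi
      omega, Finset.sum_mul, coeff_sum, Finset.sum_eq_single_of_mem 0]
    · rw [coeff_mono_mul, hg.constantCoeff, sub_zero, hf.constantCoeff]; simp
    · simp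
    · intro i hi hi0
      rw [coeff_mono_mul]
      have : coeff f (0 - i) = 0 := by
        by_contra h
        have := hf.window _ h
        rw [Finset.mem_Ico] at hi
        omega
      rw [this, map_zero, mul_zero]
  rw [hgf] at hc
  simp at hc

end IsMinimalGenerator

end SkewLaurent

/-! ### Quotients by maximal two-sided ideals. -/

section Coatom

variable {R : Type*} [Ring R] {m : TwoSidedIdeal R}

theorem IsCoatom.isSimpleRing_quotient (hm : IsCoatom m) : IsSimpleRing (R ⧸ m.asIdeal) := by
  rw [isSimpleRing_iff_isTwoSided_imp]
  refine ⟨?_, fun I hI => ?_⟩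
  · refine Ideal.Quotient.nontrivial_iff.2 fun h => hm.1 ?_
    refine eq_top_iff.2 fun x _ => ?_
    rw [← TwoSidedIdeal.mem_asIdeal, h]
    trivial
  · set J := (I.comap (Ideal.Quotient.mk m.asIdeal)).toTwoSided with hJ
    have hle : m ≤ J := fun x hx => by
      rw [hJ, Ideal.mem_toTwoSided, Ideal.mem_comap,
        Ideal.Quotient.eq_zero_iff_mem.2 (TwoSidedIdeal.mem_asIdeal.2 hx)]
      exact I.zero_mem
    rcases hm.le_iff.1 hle with h | h
    · right
      refine eq_top_iff.2 fun x _ => ?_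
      obtain ⟨x, rfl⟩ := Ideal.Quotient.mk_surjective x
      have : x ∈ J := by rw [h]; trivial
      rwa [hJ, Ideal.mem_toTwoSided, Ideal.mem_comap] at this
    · left
      refine eq_bot_iff.2 fun x hx => ?_
      obtain ⟨x, rfl⟩ := Ideal.Quotient.mk_surjective x
      have : x ∈ J := by rwa [hJ, Ideal.mem_toTwoSided, Ideal.mem_comap]
      rw [h] at this
      exact Ideal.Quotient.eq_zero_iff_mem.2 (TwoSidedIdeal.mem_asIdeal.2 this)

/-- A central element outside a maximal two-sided ideal is invertible modulo the ideal. -/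
theorem IsCoatom.exists_mul_sub_one_mem (hm : IsCoatom m) {z : R} (hz : z ∈ Subring.center R)
    (hzm : z ∉ m) : ∃ y, z * y - 1 ∈ m := by
  rw [Subring.mem_center_iff] at hz
  -- `J` is `zR + m`; it is two-sided because `z` is central, and strictly larger than `m`.
  let J : Ideal R :=
    { carrier := {x | ∃ y, z * y - x ∈ m}
      add_mem' := by
        rintro a b ⟨y, hy⟩ ⟨y', hy'⟩
        refine ⟨y + y', ?_⟩
        have := m.add_mem hy hy'
        rwa [sub_add_sub_comm, ← mul_add] at this
      zero_mem' := ⟨0, by simp [m.zero_mem]⟩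
      smul_mem' := by
        rintro c x ⟨y, hy⟩
        refine ⟨c * y, ?_⟩
        have := m.mul_mem_left c _ hy
        rwa [mul_sub, ← mul_assoc, hz, mul_assoc] at this }
  have : J.IsTwoSided := ⟨by
    rintro x b ⟨y, hy⟩
    refine ⟨y * b, ?_⟩
    have := m.mul_mem_right _ b hy
    rwa [sub_mul, mul_assoc] at this⟩
  have hlt : m < J.toTwoSided := by
    refine lt_of_le_of_ne (fun x hx => ?_) fun h => hzm ?_
    · rw [Ideal.mem_toTwoSided]
      exact ⟨0, by simpa using m.neg_mem hx⟩
    · rw [h, Ideal.mem_toTwoSided]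
      exact ⟨1, by simp [m.zero_mem]⟩
  have h1 : (1 : R) ∈ J.toTwoSided := by rw [hm.2 _ hlt]; trivial
  rwa [Ideal.mem_toTwoSided] at h1

end Coatom

/-! ### Finite inner order and nonvanishing of maximal ideals. -/

/-- If `τ^m` is conjugation by `a`, it is also conjugation by every `τ^i a`, and it fixes these
elements, so they commute. The norm `a · τ a ⋯ τ^(m-1) a` then implements `τ^(m·m)`, and it is fixed
by `τ` because `τ^m a = a`. -/
theorem HasFiniteInnerOrder.exists_fixed {D : Type*} [DivisionRing D] {τ : RingAut D}
    (hτ : HasFiniteInnerOrder τ) :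
    ∃ (k : ℕ) (c : D), 0 < k ∧ c ≠ 0 ∧ τ c = c ∧ ∀ d, (τ ^ k) d = c⁻¹ * d * c := by
  obtain ⟨m, hm, a, ha, hσ⟩ := hτ
  have hmul : ∀ (i j : ℕ) (d : D), (τ ^ i) ((τ ^ j) d) = (τ ^ (i + j)) d := fun i j d => by
    rw [pow_add]; rfl
  have hne : ∀ i : ℕ, (τ ^ i) a ≠ 0 := fun i => by
    rwa [Ne, EmbeddingLike.map_eq_zero_iff]
  have hconj : ∀ (i : ℕ) (d : D), (τ ^ m) d = ((τ ^ i) a)⁻¹ * d * (τ ^ i) a := by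
    intro i d
    obtain ⟨d, rfl⟩ := (τ ^ i).surjective d
    rw [hmul, add_comm, ← hmul, hσ, map_mul, map_mul, map_inv₀]
  have hfix : ∀ j : ℕ, (τ ^ m) ((τ ^ j) a) = (τ ^ j) a := by
    intro j
    rw [hmul, add_comm, ← hmul, hσ, inv_mul_cancel₀ ha, one_mul]
  have hcomm : ∀ i j : ℕ, Commute ((τ ^ i) a) ((τ ^ j) a) := by
    intro i j
    have h := hconj i ((τ ^ j) a)
    rw [hfix, mul_assoc] at h
    have := congrArg ((τ ^ i) a * ·) h
    simp only [mul_inv_cancel_left₀ (hne i)] at this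
    exact this
  set p : ℕ → D := fun k => ((List.range k).map fun i => (τ ^ i) a).prod with hp
  have hps : ∀ k, p (k + 1) = p k * (τ ^ k) a := fun k => List.prod_range_succ _ _
  have hp0 : ∀ k, p k ≠ 0 := by
    intro k
    induction k with
    | zero => simp [hp]
    | succ k ih => rw [hps]; exact mul_ne_zero ih (hne k)
  have hpconj : ∀ k d, (τ ^ (m * k)) d = (p k)⁻¹ * d * p k := by
    intro k
    induction k with
    | zero => simp [hp]
    | succ k ih =>
      intro d
      rw [Nat.mul_succ, add_comm, ← hmul, ih, hconj k, hps, mul_inv_rev]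
      simp only [mul_assoc]
  have hpcomm : ∀ k, Commute a (p k) := by
    intro k
    induction k with
    | zero => simp [hp]
    | succ k ih => rw [hps]; exact ih.mul_right (by simpa using hcomm 0 k)
  have hshift : ∀ k, a * τ (p k) = p k * (τ ^ k) a := by
    intro k
    induction k with
    | zero => simp [hp]
    | succ k ih =>
      rw [hps, map_mul, ← mul_assoc, ih]
      congr 1
      rw [pow_succ']; rfl
  refine ⟨m * m, p m, Nat.mul_pos hm hm, hp0 m, ?_, hpconj m⟩
  have h := hshift m
  rw [show (τ ^ m) a = a by simpa using hfix 0, ← (hpcomm m).eq] at h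
  exact mul_left_cancel₀ ha h

namespace SkewLaurent

variable {D : Type*} [DivisionRing D] {τ : RingAut D}

theorem exists_mono_mem_center (hτ : HasFiniteInnerOrder τ) :
    ∃ (k : ℕ) (c : D), 0 < k ∧ c ≠ 0 ∧ mono τ k c ∈ Subring.center (SkewLaurent τ) := by
  obtain ⟨k, c, hk, hc, hfix, hconj⟩ := hτ.exists_fixed
  refine ⟨k, c, hk, hc, mem_center_of_commute (fun a => ?_) ?_⟩
  · change mono τ 0 a * _ = _ * mono τ 0 a
    rw [mono_mul_mono, mono_mul_mono, zpow_natCast, hconj, zpow_zero, add_comm, ← mul_assoc,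
      ← mul_assoc, mul_inv_cancel₀ hc, one_mul]
    rfl
  · rw [mono_mul_mono, mono_mul_mono, map_one, mul_one, one_mul, zpow_one, hfix, add_comm]

/-- A right inverse would have to be the geometric series in `c t^k`: comparing coefficients from
below gives constant term `1`, and then nonzero coefficients in all degrees `j * k`, contradicting
finite support. -/
theorem one_sub_mono_mul_ne_one {k : ℕ} (hk : 0 < k) {c : D} (hc : c ≠ 0) (y : SkewLaurent τ) :
    (1 - mono τ k c) * y ≠ 1 := by
  intro h
  have hrec : ∀ i : ℤ, coeff y i = c * (τ ^ (k : ℤ)) (coeff y (i - k)) + if 0 = i then 1 else 0 := by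
    intro i
    have := congrArg (coeff · i) h
    rw [one_eq_mono] at this
    simp only [sub_mul, coeff_sub, coeff_mono_mul, coeff_mono] at this
    rw [← this]; simp
  obtain ⟨a, b, hw⟩ := exists_window y
  have hlow : ∀ j : ℕ, ∀ i : ℤ, i < 0 → i < a + j → coeff y i = 0 := by
    intro j
    induction j with
    | zero =>
      intro i _ hi
      by_contra hne
      have := hw i hne
      omega
    | succ j ih =>
      intro i hi0 hi
      rw [hrec, ih (i - k) (by omega) (by omega), if_neg (by omega)]; simp
  have h0 : coeff y 0 = 1 := by
    rw [hrec, hlow (-a).toNat (0 - k) (by omega) (by omega)]; simp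
  have hup : ∀ j : ℕ, coeff y (j * k) ≠ 0 := by
    intro j
    induction j with
    | zero => simp [h0]
    | succ j ih =>
      have : 0 < (j + 1) * k := by positivity
      rw [hrec, if_neg (by push_cast; exact_mod_cast this.ne)]
      push_cast
      rw [add_mul, one_mul, add_sub_cancel_right, add_zero]
      exact mul_ne_zero hc (by rwa [Ne, EmbeddingLike.map_eq_zero_iff])
  have := hw _ (hup b.toNat)
  have : (b.toNat : ℤ) * 1 ≤ b.toNat * k := by gcongr; exact_mod_cast hk
  omega

/-- If the zero ideal were maximal, the nonzero central element `1 - c t^k` would be invertible.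
This is where finite inner order enters. -/
theorem asIdeal_ne_bot (hτ : HasFiniteInnerOrder τ) {m : TwoSidedIdeal (SkewLaurent τ)}
    (hm : IsCoatom m) : m.asIdeal ≠ ⊥ := by
  intro hbot
  have hmem : ∀ x, x ∈ m → x = 0 := fun x hx => by
    rwa [← TwoSidedIdeal.mem_asIdeal, hbot, Ideal.mem_bot] at hx
  obtain ⟨k, c, hk, hc, hz⟩ := exists_mono_mem_center hτ
  have h1 : (1 - mono τ k c) ∉ m := by
    intro h
    have := congrArg (coeff · 0) (hmem _ h)
    simp only [one_eq_mono, coeff_sub, coeff_mono, coeff_zero] at this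
    rw [if_pos trivial, if_neg (by omega), sub_zero] at this
    exact one_ne_zero this
  obtain ⟨y, hy⟩ := hm.exists_mul_sub_one_mem (Subring.sub_mem _ (Subring.one_mem _) hz) h1
  exact one_sub_mono_mul_ne_one hk hc y (sub_eq_zero.1 (hmem _ hy))

end SkewLaurent

/-! ### Sylvester rank functions on matrices with arbitrary finite index types. -/

/-- Writing a reindexing as a product lets the product axiom bound its rank, for arbitrary index
maps. -/
theorem Matrix.submatrix_eq_mul_mul {R : Type*} [Semiring R] {ι κ ι' κ' : Type*} [Fintype ι]
    [Fintype κ] [DecidableEq ι] [DecidableEq κ] (X : Matrix ι κ R) (e : ι' → ι) (e' : κ' → κ) :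
    X.submatrix e e' = (1 : Matrix ι ι R).submatrix e id * X *
      (1 : Matrix κ κ R).submatrix id e' := by
  ext i j
  simp [Matrix.mul_apply, Matrix.one_apply]

/-- The extension of a function on matrices to matrices with arbitrary finite index types. -/
noncomputable def genRank {R : Type*} (rk : MatrixFunction R) {ι κ : Type*} [Fintype ι] [Fintype κ]
    (X : Matrix ι κ R) : ℝ :=
  rk (Fintype.card ι) (Fintype.card κ)
    (X.submatrix (Fintype.equivFin ι).symm (Fintype.equivFin κ).symm)

/-- The value of a function on matrices at the `1 × 1` matrix `(c)`. -/
def eltRank {R : Type*} (rk : MatrixFunction R) (c : R) : ℝ := rk 1 1 (Matrix.of fun _ _ => c)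

theorem Fin.bijective_sumElim_castSucc_last (α : Type*) (k : ℕ) :
    Function.Bijective
      (Sum.elim (fun p => (p.1, p.2.castSucc)) fun i => (i, Fin.last k) :
        (α × Fin k) ⊕ α → α × Fin (k + 1)) := by
  refine ⟨?_, ?_⟩
  · rintro (⟨a, i⟩ | a) (⟨b, j⟩ | b) hab
    · simpa using hab
    · simp [Fin.castSucc_ne_last] at hab
    · simp [(Fin.castSucc_ne_last _).symm] at hab
    · simpa using hab
  · rintro ⟨a, i⟩
    induction i using Fin.lastCases with
    | last => exact ⟨Sum.inr a, rfl⟩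
    | cast i => exact ⟨Sum.inl (a, i), rfl⟩

namespace IsSylvesterRank

variable {R : Type*} [Ring R] {rk : MatrixFunction R}
  {ι κ ι' κ' μ : Type*} [Fintype ι] [Fintype κ] [Fintype ι'] [Fintype κ'] [Fintype μ]

theorem rk_mul_le_left (h : IsSylvesterRank rk) {m n p : ℕ} (A : Matrix (Fin m) (Fin n) R) (B : Matrix (Fin n) (Fin p) R) :
    rk m p (A * B) ≤ rk m n A := (h.mul_le m n p A B).trans (min_le_left _ _)

theorem rk_mul_le_right (h : IsSylvesterRank rk) {m n p : ℕ} (A : Matrix (Fin m) (Fin n) R) (B : Matrix (Fin n) (Fin p) R) :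
    rk m p (A * B) ≤ rk n p B := (h.mul_le m n p A B).trans (min_le_right _ _)

theorem rk_submatrix_le (h : IsSylvesterRank rk) {m n m' n' : ℕ} (X : Matrix (Fin m) (Fin n) R) (e : Fin m' → Fin m)
    (e' : Fin n' → Fin n) : rk m' n' (X.submatrix e e') ≤ rk m n X := by
  rw [Matrix.submatrix_eq_mul_mul]
  exact (h.rk_mul_le_left _ _).trans (h.rk_mul_le_right _ _)

theorem genRank_submatrix_le (h : IsSylvesterRank rk) (X : Matrix ι κ R) (e : ι' → ι) (e' : κ' → κ) :
    genRank rk (X.submatrix e e') ≤ genRank rk X := by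
  have := h.rk_submatrix_le (X.submatrix (Fintype.equivFin ι).symm (Fintype.equivFin κ).symm)
    (Fintype.equivFin ι ∘ e ∘ (Fintype.equivFin ι').symm)
    (Fintype.equivFin κ ∘ e' ∘ (Fintype.equivFin κ').symm)
  rw [Matrix.submatrix_submatrix, ← Function.comp_assoc, ← Function.comp_assoc,
    Equiv.symm_comp_self, Function.id_comp, ← Function.comp_assoc, ← Function.comp_assoc,
    Equiv.symm_comp_self, Function.id_comp] at this
  exact this

theorem genRank_submatrix_of_bijective (h : IsSylvesterRank rk) (X : Matrix ι κ R) {e : ι' → ι} {e' : κ' → κ}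
    (he : e.Bijective) (he' : e'.Bijective) : genRank rk (X.submatrix e e') = genRank rk X := by
  refine le_antisymm (h.genRank_submatrix_le _ _ _) ?_
  have := h.genRank_submatrix_le (X.submatrix e e') (Equiv.ofBijective e he).symm
    (Equiv.ofBijective e' he').symm
  rwa [Matrix.submatrix_submatrix,
    show e ∘ (Equiv.ofBijective e he).symm = id from
      funext (Equiv.ofBijective_apply_symm_apply e he),
    show e' ∘ (Equiv.ofBijective e' he').symm = id from
      funext (Equiv.ofBijective_apply_symm_apply e' he'), Matrix.submatrix_id_id] at this

theorem genRank_eq_rk (h : IsSylvesterRank rk) {m n : ℕ} (X : Matrix (Fin m) (Fin n) R) : genRank rk X = rk m n X := by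
  refine le_antisymm (h.rk_submatrix_le _ _ _) ?_
  have := h.rk_submatrix_le (X.submatrix (Fintype.equivFin (Fin m)).symm
    (Fintype.equivFin (Fin n)).symm) (Fintype.equivFin (Fin m)) (Fintype.equivFin (Fin n))
  rwa [Matrix.submatrix_submatrix, Equiv.symm_comp_self, Equiv.symm_comp_self,
    Matrix.submatrix_id_id] at this

theorem genRank_mul_le_left (h : IsSylvesterRank rk) (A : Matrix ι κ R) (B : Matrix κ μ R) :
    genRank rk (A * B) ≤ genRank rk A := by
  unfold genRank
  rw [← Matrix.submatrix_mul_equiv A B _ (Fintype.equivFin κ).symm]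
  exact h.rk_mul_le_left _ _

theorem genRank_mul_le_right (h : IsSylvesterRank rk) (A : Matrix ι κ R) (B : Matrix κ μ R) :
    genRank rk (A * B) ≤ genRank rk B := by
  unfold genRank
  rw [← Matrix.submatrix_mul_equiv A B _ (Fintype.equivFin κ).symm]
  exact h.rk_mul_le_right _ _

theorem genRank_mul_mul_eq (h : IsSylvesterRank rk) [DecidableEq ι] [DecidableEq κ] {P P' : Matrix ι ι R}
    {Q Q' : Matrix κ κ R} (hP : P' * P = 1) (hQ : Q * Q' = 1) (X : Matrix ι κ R) :
    genRank rk (P * X * Q) = genRank rk X := by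
  refine le_antisymm ((h.genRank_mul_le_left _ _).trans (h.genRank_mul_le_right _ _)) ?_
  calc genRank rk X = genRank rk (P' * (P * X * Q) * Q') := by
        rw [Matrix.mul_assoc P, ← Matrix.mul_assoc P', hP, Matrix.one_mul, Matrix.mul_assoc, hQ,
          Matrix.mul_one]
    _ ≤ _ := (h.genRank_mul_le_left _ _).trans (h.genRank_mul_le_right _ _)

theorem genRank_zero (h : IsSylvesterRank rk) : genRank rk (0 : Matrix ι κ R) = 0 := h.zero _ _

theorem genRank_fromBlocks_upper_eq (h : IsSylvesterRank rk) (A : Matrix ι κ R) (C : Matrix ι κ' R) (B : Matrix ι' κ' R) :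
    genRank rk (Matrix.fromBlocks A C 0 B) = rk _ _ (upperBlock
      (A.submatrix (Fintype.equivFin ι).symm (Fintype.equivFin κ).symm)
      (C.submatrix (Fintype.equivFin ι).symm (Fintype.equivFin κ').symm)
      (B.submatrix (Fintype.equivFin ι').symm (Fintype.equivFin κ').symm)) := by
  rw [← h.genRank_eq_rk, ← h.genRank_submatrix_of_bijective (Matrix.fromBlocks A C 0 B)
    (finSumFinEquiv.symm.trans
      (Equiv.sumCongr (Fintype.equivFin ι).symm (Fintype.equivFin ι').symm)).bijective
    (finSumFinEquiv.symm.trans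
      (Equiv.sumCongr (Fintype.equivFin κ).symm (Fintype.equivFin κ').symm)).bijective]
  congr 1
  ext i j
  simp only [upperBlock, Matrix.reindex_apply, Matrix.submatrix_apply, Equiv.trans_apply]
  rcases finSumFinEquiv.symm i with i | i <;> rcases finSumFinEquiv.symm j with j | j <;> rfl

theorem genRank_fromBlocks_diag (h : IsSylvesterRank rk) (A : Matrix ι κ R) (B : Matrix ι' κ' R) :
    genRank rk (Matrix.fromBlocks A 0 0 B) = genRank rk A + genRank rk B := by
  rw [h.genRank_fromBlocks_upper_eq, Matrix.submatrix_zero]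
  exact h.diag _ _ _ _ _ _

theorem genRank_fromBlocks_upper (h : IsSylvesterRank rk) (A : Matrix ι κ R) (C : Matrix ι κ' R) (B : Matrix ι' κ' R) :
    genRank rk A + genRank rk B ≤ genRank rk (Matrix.fromBlocks A C 0 B) := by
  rw [h.genRank_fromBlocks_upper_eq]
  exact h.upper _ _ _ _ _ _ _

theorem genRank_blockDiagonal (h : IsSylvesterRank rk) (X : Matrix ι κ R) (k : ℕ) :
    genRank rk (Matrix.blockDiagonal fun _ : Fin k => X) = k * genRank rk X := by
  induction k with
  | zero =>
    rw [show (Matrix.blockDiagonal fun _ : Fin 0 => X) = 0 from Matrix.ext fun i => i.2.elim0,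
      h.genRank_zero]
    simp
  | succ k ih =>
    rw [← h.genRank_submatrix_of_bijective _ (Fin.bijective_sumElim_castSucc_last ι k)
      (Fin.bijective_sumElim_castSucc_last κ k), Nat.cast_succ, add_mul, one_mul, ← ih,
      ← h.genRank_fromBlocks_diag]
    congr 1
    ext (i | i) (j | j) <;>
      simp [Matrix.blockDiagonal_apply, Fin.castSucc_ne_last, (Fin.castSucc_ne_last _).symm]

theorem genRank_smul_one (h : IsSylvesterRank rk) (c : R) (k : ℕ) :
    genRank rk (c • (1 : Matrix (Fin k) (Fin k) R)) = k * eltRank rk c := by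
  rw [eltRank, ← h.genRank_eq_rk, ← h.genRank_blockDiagonal]
  have hb : Function.Bijective fun i : Fin k => ((0 : Fin 1), i) :=
    ⟨fun i j hij => by simpa using hij, fun ⟨a, i⟩ => ⟨i, by simp [Subsingleton.elim a 0]⟩⟩
  rw [← h.genRank_submatrix_of_bijective _ hb hb]
  congr 1
  ext i j
  simp [Matrix.blockDiagonal_apply, Matrix.one_apply]

end IsSylvesterRank

theorem Matrix.mul_smul_of_commute {R : Type*} [Ring R] {ι κ μ : Type*} [Fintype κ] {c : R}
    (hc : ∀ x, Commute c x) (A : Matrix ι κ R) (B : Matrix κ μ R) : A * c • B = c • (A * B) := by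
  ext i j
  simp only [Matrix.mul_apply, Matrix.smul_apply, smul_eq_mul, Finset.mul_sum, ← mul_assoc]
  exact Finset.sum_congr rfl fun x _ => by rw [(hc _).eq]

/-- If `A X B = 1` with `A X B` of size `k` and `c` is central, then the rank of `c X` is that of
`diag(c, …, c, c (X - X B A X))`. -/
theorem IsSylvesterRank.genRank_smul_eq_add {R : Type*} [Ring R] {rk : MatrixFunction R}
    (h : IsSylvesterRank rk) {ι κ : Type*} [Fintype ι] [Fintype κ] [DecidableEq ι] [DecidableEq κ]
    {k : ℕ} {c : R} (hc : ∀ x, Commute c x) {X : Matrix ι κ R} {A : Matrix (Fin k) ι R}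
    {B : Matrix κ (Fin k) R} (hAB : A * X * B = 1) :
    genRank rk (c • X) =
      k * eltRank rk c + genRank rk (c • (X - X * B * (A * X))) := by
  -- Row and column operations bring both `diag(0, c X)` and `diag(c, c (X - X B A X))` to the block
  -- matrix with rows `(c, c A X)` and `(c X B, c X)`.
  have h1 := h.genRank_mul_mul_eq (P := Matrix.fromBlocks 1 A 0 1) (P' := Matrix.fromBlocks 1 (-A) 0 1)
    (Q := Matrix.fromBlocks 1 0 B 1) (Q' := Matrix.fromBlocks 1 0 (-B) 1)
    (by simp [Matrix.fromBlocks_multiply]) (by simp [Matrix.fromBlocks_multiply])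
    (Matrix.fromBlocks (0 : Matrix (Fin k) (Fin k) R) 0 0 (c • X))
  have h2 := h.genRank_mul_mul_eq (P := Matrix.fromBlocks 1 0 (X * B) 1)
    (P' := Matrix.fromBlocks 1 0 (-(X * B)) 1)
    (Q := Matrix.fromBlocks 1 (A * X) 0 1) (Q' := Matrix.fromBlocks 1 (-(A * X)) 0 1)
    (by simp [Matrix.fromBlocks_multiply]) (by simp [Matrix.fromBlocks_multiply])
    (Matrix.fromBlocks (c • (1 : Matrix (Fin k) (Fin k) R)) 0 0 (c • (X - X * B * (A * X))))
  rw [h.genRank_fromBlocks_diag, h.genRank_zero, zero_add] at h1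
  rw [h.genRank_fromBlocks_diag, h.genRank_smul_one] at h2
  rw [← h1, ← h2]
  congr 1
  simp only [Matrix.fromBlocks_multiply, Matrix.one_mul, Matrix.mul_one, Matrix.zero_mul,
    Matrix.mul_zero, zero_add, add_zero, Matrix.mul_smul_of_commute hc, Matrix.smul_mul, hAB,
    ← smul_add, add_sub_cancel]

/-! ### Splitting matrices over a simple Artinian ring and reducing modulo a nilpotent. -/

/-- Rank factorization: the map on row vectors is a surjection onto its range followed by an
inclusion, and both split. -/
theorem DivisionRing.exists_matrix_factorization {E : Type*} [DivisionRing E] {ι κ : Type*}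
    [Fintype ι] [Fintype κ] [DecidableEq ι] [DecidableEq κ] (X : Matrix ι κ E) :
    ∃ (s : ℕ) (A : Matrix ι (Fin s) E) (B : Matrix (Fin s) κ E) (A' : Matrix (Fin s) ι E)
      (B' : Matrix κ (Fin s) E), X = A * B ∧ A' * A = 1 ∧ B * B' = 1 := by
  set g : (ι → E) →ₗ[E] (κ → E) := Matrix.toLinearMapRight' X with hg
  let b := Module.finBasis E (LinearMap.range g)
  set p : (ι → E) →ₗ[E] (Fin _ → E) := b.equivFun.toLinearMap ∘ₗ g.rangeRestrict with hp
  set q : (Fin _ → E) →ₗ[E] (κ → E) := (LinearMap.range g).subtype ∘ₗ b.equivFun.symm.toLinearMap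
    with hq
  have hgpq : q ∘ₗ p = g := by ext; simp [hp, hq]
  obtain ⟨p', hp'⟩ := p.exists_rightInverse_of_surjective
    (LinearMap.range_eq_top.2 (b.equivFun.surjective.comp g.surjective_rangeRestrict))
  obtain ⟨q', hq'⟩ := q.exists_leftInverse_of_injective
    (LinearMap.ker_eq_bot.2 ((Submodule.subtype_injective _).comp b.equivFun.symm.injective))
  refine ⟨_, Matrix.toLinearMapRight'.symm p, Matrix.toLinearMapRight'.symm q,
    Matrix.toLinearMapRight'.symm p', Matrix.toLinearMapRight'.symm q', ?_, ?_, ?_⟩ <;>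
  apply Matrix.toLinearMapRight'.injective <;>
  simp only [Matrix.toLinearMapRight'_mul, LinearEquiv.apply_symm_apply, Matrix.toLinearMapRight'_one]
  exacts [hgpq.symm, hp', hq']

/-- Over `Matrix (Fin r) (Fin r) E`, the direct sum of `r` copies of a matrix factors through a
free module as a split epimorphism followed by a split monomorphism. -/
theorem DivisionRing.exists_blockDiagonal_factorization {E : Type*} [DivisionRing E] {ι κ : Type*}
    [Fintype ι] [Fintype κ] [DecidableEq ι] [DecidableEq κ] {r : ℕ}
    (X : Matrix ι κ (Matrix (Fin r) (Fin r) E)) :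
    ∃ (s : ℕ) (A : Matrix (ι × Fin r) (Fin s) (Matrix (Fin r) (Fin r) E))
      (B : Matrix (Fin s) (κ × Fin r) (Matrix (Fin r) (Fin r) E))
      (A' : Matrix (Fin s) (ι × Fin r) (Matrix (Fin r) (Fin r) E))
      (B' : Matrix (κ × Fin r) (Fin s) (Matrix (Fin r) (Fin r) E)),
      (Matrix.blockDiagonal fun _ => X) = A * B ∧ A' * A = 1 ∧ B * B' = 1 := by
  obtain ⟨s, A, B, A', B', hX, hA, hB⟩ :=
    DivisionRing.exists_matrix_factorization (Matrix.comp ι κ (Fin r) (Fin r) E X)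
  have hdiag : ∀ (l l' : Fin s) (x : Fin r),
      (1 : Matrix (Fin s) (Fin s) (Matrix (Fin r) (Fin r) E)) l l' x x =
        (1 : Matrix (Fin s) (Fin s) E) l l' := fun l l' x => by
    by_cases hl : l = l' <;> simp [Matrix.one_apply, hl]
  -- The image of `X` is a sum of `s` simple modules, and `r` may fail to divide `s`; `r` copies of
  -- it form a free module of rank `s`. Copy `u` uses only the `u`-th column of the entries of the
  -- left factor and the `u`-th row of those of the right factor, so distinct copies do not
  -- interact.
  refine ⟨s, Matrix.of fun p l => Matrix.of fun x y => if p.2 = y then A (p.1, x) l else 0,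
    Matrix.of fun l p => Matrix.of fun x y => if x = p.2 then B l (p.1, y) else 0,
    Matrix.of fun l p => Matrix.of fun x y => if x = p.2 then A' l (p.1, y) else 0,
    Matrix.of fun p l => Matrix.of fun x y => if p.2 = y then B' (p.1, x) l else 0, ?_, ?_, ?_⟩
  · ext ⟨i, u⟩ ⟨j, v⟩ x y
    have := congrFun (congrFun hX (i, x)) (j, y)
    rw [Matrix.comp_apply, Matrix.mul_apply] at this
    simp only [Matrix.blockDiagonal_apply, Matrix.mul_apply, Matrix.sum_apply, Matrix.of_apply,
      ite_mul, mul_ite, zero_mul, mul_zero]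
    by_cases h : u = v
    · simp [h, this]
    · simp [h]
  · ext l l' x y
    have := congrFun (congrFun hA l) l'
    rw [Matrix.mul_apply, Fintype.sum_prod_type] at this
    simp only [Matrix.mul_apply, Matrix.sum_apply, Matrix.of_apply, ite_mul, mul_ite,
      zero_mul, mul_zero, Fintype.sum_prod_type]
    by_cases h : x = y
    · subst h
      rw [hdiag, ← this]
      simp
    · by_cases hl : l = l' <;> simp [Matrix.one_apply, h, hl]
  · ext l l' x y
    have := congrFun (congrFun hB l) l'
    rw [Matrix.mul_apply, Fintype.sum_prod_type] at this
    simp only [Matrix.mul_apply, Matrix.sum_apply, Matrix.of_apply, ite_mul, mul_ite,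
      zero_mul, mul_zero, Fintype.sum_prod_type]
    by_cases h : x = y
    · subst h
      rw [hdiag, ← this]
      simp
    · by_cases hl : l = l' <;> simp [Matrix.one_apply, h, hl]

/-- `S` is a ring with a central nilpotent element `f`, `fⁿ = 0`, such that `S/fS` is simple
Artinian (hence a matrix ring over a division ring). -/
structure IsSimpleModNilpotent.{u} {S : Type u} [Ring S] (f : S) (n : ℕ) : Prop where
  commute : ∀ x, Commute f x
  pow_eq_zero : f ^ n = 0
  exists_hom : ∃ (E : Type u) (_ : DivisionRing E) (r : ℕ) (π : S →+* Matrix (Fin r) (Fin r) E),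
    0 < r ∧ Function.Surjective π ∧ ∀ x, π x = 0 → ∃ y, x = f * y

namespace IsSimpleModNilpotent

variable {S : Type*} [Ring S] {f : S} {n : ℕ}

/-- Lift the splitting of `r` copies of `X` from the quotient: the lifted identity block is
invertible because the error is nilpotent, and its complement vanishes modulo `f`. The same `s` and
`Y` serve every rank function and every `i`, so two rank functions can be compared. -/
theorem exists_reduction {E : Type*} [DivisionRing E] {r : ℕ} (hf : ∀ x, Commute f x)
    (hn : f ^ n = 0) (π : S →+* Matrix (Fin r) (Fin r) E) (hπ : Function.Surjective π)
    (hker : ∀ x, π x = 0 → ∃ y, x = f * y) {ι κ : Type} [Fintype ι] [Fintype κ] [DecidableEq ι]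
    [DecidableEq κ] (X : Matrix ι κ S) :
    ∃ (s : ℕ) (Y : Matrix (ι × Fin r) (κ × Fin r) S), ∀ rk : MatrixFunction S,
      IsSylvesterRank rk → ∀ i, r * genRank rk (f ^ i • X) =
        s * eltRank rk (f ^ i) + genRank rk (f ^ (i + 1) • Y) := by
  obtain ⟨s, A, B, A', B', hX, hA, hB⟩ :=
    DivisionRing.exists_blockDiagonal_factorization (X.map π)
  have hlift : ∀ {α β : Type} (M : Matrix α β (Matrix (Fin r) (Fin r) E)),
      ∃ N : Matrix α β S, N.map π = M := fun M =>
    ⟨Matrix.of fun i j => (hπ (M i j)).choose,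
      Matrix.ext fun i j => (hπ (M i j)).choose_spec⟩
  have hsmul : ∀ {α β : Type} (N : Matrix α β S), N.map π = 0 → ∃ Y : Matrix α β S, N = f • Y := by
    intro α β N hN
    have : ∀ i j, ∃ y, N i j = f * y := fun i j => hker _ (congrFun (congrFun hN i) j)
    choose Y hY using this
    exact ⟨Matrix.of Y, Matrix.ext hY⟩
  obtain ⟨A₀, hA₀⟩ := hlift A'
  obtain ⟨B₀, hB₀⟩ := hlift B'
  set X' : Matrix (ι × Fin r) (κ × Fin r) S := Matrix.blockDiagonal fun _ => X with hX'
  have hX'map : X'.map π = A * B := by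
    rw [← hX, hX', Matrix.blockDiagonal_map _ _ (map_zero π)]
  have hone : (1 : Matrix (Fin s) (Fin s) S).map π = 1 :=
    Matrix.map_one _ (map_zero π) (map_one π)
  have hU : (A₀ * X' * B₀).map π = 1 := by
    rw [Matrix.map_mul, Matrix.map_mul, hA₀, hB₀, hX'map, ← Matrix.mul_assoc, hA, Matrix.one_mul, hB]
  obtain ⟨W, hW⟩ := hsmul (A₀ * X' * B₀ - 1) (by
    rw [Matrix.map_sub _ (map_sub π), hU, hone, sub_self])
  have hpow : ∀ k : ℕ, (f • W) ^ k = f ^ k • W ^ k := by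
    intro k
    induction k with
    | zero => simp
    | succ k ih =>
      rw [pow_succ, ih, Matrix.mul_smul_of_commute hf, Matrix.smul_mul, smul_smul, pow_succ',
        pow_succ]
  have hunit : IsUnit (A₀ * X' * B₀) := by
    rw [← sub_add_cancel (A₀ * X' * B₀) 1, hW]
    exact IsNilpotent.isUnit_add_one ⟨n, by rw [hpow, hn, zero_smul]⟩
  obtain ⟨V, hV⟩ := hunit.exists_left_inv
  have hVmap : V.map π = 1 := by
    have := congrArg (Matrix.map · π) hV
    simpa only [Matrix.map_mul, hU, Matrix.mul_one, hone] using this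
  obtain ⟨Y, hY⟩ := hsmul (X' - X' * B₀ * (V * A₀ * X')) (by
    rw [Matrix.map_sub _ (map_sub π), Matrix.map_mul, Matrix.map_mul, Matrix.map_mul,
      Matrix.map_mul, hVmap, hA₀, hB₀, hX'map, Matrix.one_mul, Matrix.mul_assoc A, hB,
      Matrix.mul_one, ← Matrix.mul_assoc A', hA, Matrix.one_mul, sub_self])
  refine ⟨s, Y, fun rk h i => ?_⟩
  have hc : ∀ x, Commute (f ^ i) x := fun x => (hf x).pow_left i
  have h1 := h.genRank_smul_eq_add hc (X := X') (A := V * A₀) (B := B₀)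
    (by rw [Matrix.mul_assoc, Matrix.mul_assoc, ← Matrix.mul_assoc A₀, hV])
  rw [hY, smul_smul, ← pow_succ] at h1
  rw [← h1, ← h.genRank_blockDiagonal]
  congr 1
  ext p q
  simp [hX', Matrix.blockDiagonal_apply]

/-- Descending induction on the power of `f` in front of the matrix, starting from `f ^ n = 0`. Each
reduction step expresses `r` times one rank through a rank with a higher power, and `r` is
cancelled. -/
theorem rank_ext (hf : IsSimpleModNilpotent f n) {rk rk' : MatrixFunction S}
    (h : IsSylvesterRank rk) (h' : IsSylvesterRank rk')
    (heq : ∀ i, eltRank rk (f ^ i) = eltRank rk' (f ^ i)) : rk = rk' := by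
  obtain ⟨E, _, r, π, hr, hπ, hker⟩ := hf.exists_hom
  -- The index types vary in the induction since each reduction multiplies them by `Fin r`.
  have key : ∀ j i : ℕ, n ≤ i + j → ∀ (ι κ : Type) [Fintype ι] [Fintype κ] [DecidableEq ι]
      [DecidableEq κ] (X : Matrix ι κ S), genRank rk (f ^ i • X) = genRank rk' (f ^ i • X) := by
    intro j
    induction j with
    | zero =>
      intro i hi ι κ _ _ _ _ X
      rw [pow_eq_zero_of_le (by simpa using hi) hf.pow_eq_zero, zero_smul, h.genRank_zero,
        h'.genRank_zero]
    | succ j ih =>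
      intro i hi ι κ _ _ _ _ X
      obtain ⟨s, Y, hY⟩ := exists_reduction hf.commute hf.pow_eq_zero π hπ hker X
      have h1 := hY rk h i
      rw [heq, ih (i + 1) (by omega), ← hY rk' h' i] at h1
      exact mul_left_cancel₀ (by exact_mod_cast hr.ne') h1
  funext a b X
  have := key n 0 (by simp) _ _ X
  rwa [pow_zero, one_smul, h.genRank_eq_rk, h'.genRank_eq_rk] at this

end IsSimpleModNilpotent

/-! ### Convexity of the ranks of powers, pullbacks, and convexity of the spaces of rank functions.
-/

namespace IsSylvesterRank

variable {S : Type*} [Ring S] {rk : MatrixFunction S}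

theorem eltRank_zero (h : IsSylvesterRank rk) : eltRank rk (0 : S) = 0 := by
  have := h.zero 1 1
  exact this

theorem eltRank_one (h : IsSylvesterRank rk) : eltRank rk (1 : S) = 1 := by
  have := h.one
  rwa [show (1 : Matrix (Fin 1) (Fin 1) S) = Matrix.of fun _ _ => 1 by
    ext i j; simp [Matrix.one_apply, Subsingleton.elim i j]] at this

/-- The upper triangular block with `f^(i+1)` twice on the diagonal and `f^i` in the corner has rank
at least the left side. It also factors through `diag(f^i, f^(i+2))`. -/
theorem eltRank_convex (h : IsSylvesterRank rk) (f : S) (i : ℕ) :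
    2 * eltRank rk (f ^ (i + 1)) ≤ eltRank rk (f ^ i) + eltRank rk (f ^ (i + 2)) := by
  let e : S → Matrix (Fin 1) (Fin 1) S := fun c => Matrix.of fun _ _ => c
  have hmul : ∀ a b, e a * e b = e (a * b) := fun a b => by ext i j; simp [e, Matrix.mul_apply]
  have hadd : ∀ a b, e a + e b = e (a + b) := fun a b => by ext i j; simp [e]
  have hzero : e 0 = 0 := rfl
  have helt : ∀ c, eltRank rk c = genRank rk (e c) := fun c => (h.genRank_eq_rk _).symm
  rw [helt, helt, helt, two_mul, ← h.genRank_fromBlocks_diag (e (f ^ i))]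
  refine (h.genRank_fromBlocks_upper (e (f ^ (i + 1))) (e (f ^ i)) (e (f ^ (i + 1)))).trans ?_
  have : Matrix.fromBlocks (e (f ^ (i + 1))) (e (f ^ i)) 0 (e (f ^ (i + 1))) =
      Matrix.fromBlocks (e 1) (e 0) (e f) (e (-1)) *
        Matrix.fromBlocks (e (f ^ i)) 0 0 (e (f ^ (i + 2))) *
        Matrix.fromBlocks (e f) (e 1) (e 1) (e 0) := by
    simp only [← hzero, Matrix.fromBlocks_multiply, hmul, hadd]
    congr 2 <;> simp [pow_succ', mul_assoc, pow_mul_comm']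
  rw [this]
  exact (h.genRank_mul_le_left _ _).trans (h.genRank_mul_le_right _ _)

end IsSylvesterRank

theorem upperBlock_map {R S : Type*} [Ring R] [Ring S] (φ : R →+* S) {m n p q : ℕ}
    (A : Matrix (Fin m) (Fin n) R) (C : Matrix (Fin m) (Fin q) R) (B : Matrix (Fin p) (Fin q) R) :
    (upperBlock A C B).map φ = upperBlock (A.map φ) (C.map φ) (B.map φ) := by
  rw [upperBlock, upperBlock, Matrix.reindex_apply, ← Matrix.submatrix_map, Matrix.fromBlocks_map,
    Matrix.map_zero _ (map_zero φ)]
  rfl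

theorem IsSylvesterRank.pullback {R S : Type*} [Ring R] [Ring S] (φ : R →+* S)
    {rk : MatrixFunction S} (h : IsSylvesterRank rk) : IsSylvesterRank (pullback φ rk) where
  nonneg m n A := h.nonneg _ _ _
  zero m n := by
    simp only [_root_.pullback]
    rw [Matrix.map_zero _ (map_zero φ), h.zero]
  one := by
    simp only [_root_.pullback]
    rw [Matrix.map_one _ (map_zero φ) (map_one φ), h.one]
  mul_le m n p A B := by
    simp only [_root_.pullback]
    rw [Matrix.map_mul]
    exact h.mul_le _ _ _ _ _
  diag m n p q A B := by
    simp only [_root_.pullback]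
    rw [upperBlock_map, Matrix.map_zero _ (map_zero φ), h.diag]
  upper m n p q A C B := by
    simp only [_root_.pullback]
    rw [upperBlock_map]
    exact h.upper _ _ _ _ _ _ _

theorem eltRank_pullback {R S : Type*} [Ring R] [Ring S] (φ : R →+* S)
    (rk : MatrixFunction S) (c : R) : eltRank (pullback φ rk) c = eltRank rk (φ c) := rfl

theorem convex_sylvesterRanks (R : Type*) [Ring R] : Convex ℝ (sylvesterRanks R) := by
  intro x (hx : IsSylvesterRank x) y (hy : IsSylvesterRank y) a b ha hb hab
  exact
    { nonneg := fun m n A => add_nonneg (mul_nonneg ha (hx.nonneg m n A))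
        (mul_nonneg hb (hy.nonneg m n A))
      zero := fun m n => by
        change a * x m n 0 + b * y m n 0 = 0
        rw [hx.zero, hy.zero]; simp
      one := by
        change a * x 1 1 1 + b * y 1 1 1 = 1
        rw [hx.one, hy.one]; simpa using hab
      mul_le := fun m n p A B => le_min
        (add_le_add (mul_le_mul_of_nonneg_left (hx.rk_mul_le_left A B) ha)
          (mul_le_mul_of_nonneg_left (hy.rk_mul_le_left A B) hb))
        (add_le_add (mul_le_mul_of_nonneg_left (hx.rk_mul_le_right A B) ha)
          (mul_le_mul_of_nonneg_left (hy.rk_mul_le_right A B) hb))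
      diag := fun m n p q A B => by
        change a * x _ _ _ + b * y _ _ _ = (a * x _ _ _ + b * y _ _ _) + (a * x _ _ _ + b * y _ _ _)
        rw [hx.diag, hy.diag]; ring
      upper := fun m n p q A C B => by
        change (a * x _ _ _ + b * y _ _ _) + (a * x _ _ _ + b * y _ _ _) ≤ a * x _ _ _ + b * y _ _ _
        have h1 := mul_le_mul_of_nonneg_left (hx.upper m n p q A C B) ha
        have h2 := mul_le_mul_of_nonneg_left (hy.upper m n p q A C B) hb
        linarith }

theorem regularRanks_subset (R : Type*) [Ring R] : regularRanks R ⊆ sylvesterRanks R := by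
  rintro _ ⟨U, _, φ, rk', _, h, rfl⟩
  exact IsSylvesterRank.pullback φ h

/-- A convex combination lives on the product of the two regular rings, as the same combination of
the rank functions pulled back along the projections. -/
theorem convex_regularRanks (R : Type*) [Ring R] : Convex ℝ (regularRanks R) := by
  rintro _ ⟨U, _, φ, rk, hU, h, rfl⟩ _ ⟨U', _, φ', rk', hU', h', rfl⟩ a b ha hb hab
  refine ⟨U × U', inferInstance, φ.prod φ',
    a • pullback (RingHom.fst U U') rk + b • pullback (RingHom.snd U U') rk', fun x => ?_,
    convex_sylvesterRanks _ (IsSylvesterRank.pullback _ h) (IsSylvesterRank.pullback _ h') ha hb hab,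
    rfl⟩
  obtain ⟨y, hy⟩ := hU x.1
  obtain ⟨y', hy'⟩ := hU' x.2
  exact ⟨(y, y'), Prod.ext hy hy'⟩

theorem eltRank_sum {S ι : Type*} (s : Finset ι) (w : ι → ℝ) (ρ : ι → MatrixFunction S) (c : S) :
    eltRank (∑ j ∈ s, w j • ρ j) c = ∑ j ∈ s, w j * eltRank (ρ j) c := by
  simp only [eltRank, Finset.sum_apply, Pi.smul_apply, smul_eq_mul]

/-! ### Barycentric coordinates and the simplex of rank functions. -/

/-- The coefficient of the `j`-th vertex in the barycentric coordinates of a rank function. -/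
def rankCoord {S : Type*} [Ring S] (f : S) (rk : MatrixFunction S) (j : ℕ) : ℝ :=
  (j + 1) * (eltRank rk (f ^ j) - 2 * eltRank rk (f ^ (j + 1)) + eltRank rk (f ^ (j + 2)))

/-- Double summation by parts. The weights vanish for `j < i`, so the sum recovers `r i` up to
boundary terms at `i + d` and `i + d + 1`. -/
theorem sum_range_max_mul_secondDifference (r : ℕ → ℝ) (i d : ℕ) :
    ∑ j ∈ Finset.range (i + d), max 0 ((j : ℝ) + 1 - i) * (r j - 2 * r (j + 1) + r (j + 2)) =
      r i - (d + 1) * r (i + d) + d * r (i + d + 1) := by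
  induction d with
  | zero =>
    rw [Finset.sum_eq_zero]
    · simp
    · intro j hj
      have : (j : ℝ) + 1 ≤ i := by exact_mod_cast Finset.mem_range.1 hj
      rw [max_eq_left (by linarith), zero_mul]
  | succ d ih =>
    rw [← add_assoc, Finset.sum_range_succ, ih, max_eq_right]
    · push_cast
      rw [add_right_comm i d 2]
      ring_nf
    · push_cast
      have : (0 : ℝ) ≤ d := d.cast_nonneg
      linarith

theorem sum_range_max_mul_secondDifference_eq (r : ℕ → ℝ) {n : ℕ} (hr : ∀ i, n ≤ i → r i = 0)
    (i : ℕ) :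
    ∑ j ∈ Finset.range n, max 0 ((j : ℝ) + 1 - i) * (r j - 2 * r (j + 1) + r (j + 2)) = r i := by
  rcases le_total i n with h | h
  · obtain ⟨d, rfl⟩ := Nat.exists_eq_add_of_le h
    rw [sum_range_max_mul_secondDifference, hr (i + d) le_rfl, hr (i + d + 1) (by omega)]
    ring
  · rw [hr i h, Finset.sum_eq_zero]
    intro j hj
    have h1 : (j : ℝ) + 1 ≤ n := by exact_mod_cast Finset.mem_range.1 hj
    have h2 : (n : ℝ) ≤ i := by exact_mod_cast h
    rw [max_eq_left (by linarith), zero_mul]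

namespace IsSimpleModNilpotent

variable {S : Type*} [Ring S] {f : S} {n : ℕ}

theorem eltRank_eq_zero (hf : IsSimpleModNilpotent f n) {rk : MatrixFunction S}
    (h : IsSylvesterRank rk) {i : ℕ} (hi : n ≤ i) : eltRank rk (f ^ i) = 0 := by
  rw [pow_eq_zero_of_le hi hf.pow_eq_zero, h.eltRank_zero]

theorem rankCoord_nonneg {rk : MatrixFunction S} (h : IsSylvesterRank rk) (j : ℕ) :
    0 ≤ rankCoord f rk j :=
  mul_nonneg (by positivity) (by linarith [h.eltRank_convex f j])

theorem sum_rankCoord_mul (hf : IsSimpleModNilpotent f n) {rk : MatrixFunction S}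
    (h : IsSylvesterRank rk) (i : ℕ) :
    ∑ j : Fin n, rankCoord f rk j * max 0 (1 - (i : ℝ) / ((j : ℕ) + 1)) = eltRank rk (f ^ i) := by
  rw [← sum_range_max_mul_secondDifference_eq (fun i => eltRank rk (f ^ i))
    (fun i hi => hf.eltRank_eq_zero h hi) i, Finset.sum_range]
  refine Finset.sum_congr rfl fun j _ => ?_
  have hj : (0 : ℝ) < (j : ℕ) + 1 := by positivity
  have : max 0 (((j : ℕ) : ℝ) + 1 - i) = ((j : ℕ) + 1) * max 0 (1 - (i : ℝ) / ((j : ℕ) + 1)) := by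
    rw [mul_max_of_nonneg _ _ hj.le, mul_zero, mul_sub, mul_one, mul_div_cancel₀ _ hj.ne']
  rw [this, rankCoord]
  ring

theorem sum_rankCoord (hf : IsSimpleModNilpotent f n) {rk : MatrixFunction S}
    (h : IsSylvesterRank rk) : ∑ j : Fin n, rankCoord f rk j = 1 := by
  have := hf.sum_rankCoord_mul h 0
  simpa [h.eltRank_one] using this

/-- A hinge sequence is linear on each side of its kink at `k + 1`, so its only nonzero second
difference is the one centred there, equal to `1/(k+1)`. -/
theorem rankCoord_vertex {ρ : MatrixFunction S} {k : ℕ}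
    (hρ : ∀ i : ℕ, eltRank ρ (f ^ i) = max 0 (1 - (i : ℝ) / (k + 1))) (j : ℕ) :
    rankCoord f ρ j = if j = k then 1 else 0 := by
  have hk : (0 : ℝ) < k + 1 := by positivity
  have hle : ∀ i : ℕ, i ≤ k + 1 → eltRank ρ (f ^ i) = 1 - (i : ℝ) / (k + 1) := fun i hi => by
    rw [hρ, max_eq_right]
    rw [sub_nonneg, div_le_one hk]
    exact_mod_cast hi
  have hge : ∀ i : ℕ, k + 1 ≤ i → eltRank ρ (f ^ i) = 0 := fun i hi => by
    rw [hρ, max_eq_left]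
    rw [sub_nonpos, one_le_div hk]
    exact_mod_cast hi
  rw [rankCoord]
  rcases lt_trichotomy j k with h | h | h
  · rw [hle _ (by omega), hle _ (by omega), hle _ (by omega), if_neg h.ne]
    push_cast
    field_simp
    ring
  · subst h
    rw [hle _ (by omega), hge _ le_rfl, hge _ (by omega), if_pos rfl]
    field_simp
    ring
  · rw [hge _ (by omega), hge _ (by omega), hge _ (by omega), if_neg h.ne']
    ring

theorem rankCoord_combo (a b : ℝ) (x y : MatrixFunction S) (j : ℕ) :
    rankCoord f (a • x + b • y) j = a * rankCoord f x j + b * rankCoord f y j := by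
  have : ∀ c : S, eltRank (a • x + b • y) c = a * eltRank x c + b * eltRank y c := fun _ => rfl
  simp only [rankCoord, this]
  ring

theorem eq_sum_vertices (hf : IsSimpleModNilpotent f n) {ρ : Fin n → MatrixFunction S}
    (hρ : ∀ j, IsSylvesterRank (ρ j))
    (hρf : ∀ j, ∀ i : ℕ, eltRank (ρ j) (f ^ i) = max 0 (1 - (i : ℝ) / ((j : ℕ) + 1)))
    {rk : MatrixFunction S} (h : IsSylvesterRank rk) : rk = ∑ j : Fin n, rankCoord f rk j • ρ j := by
  refine hf.rank_ext h ((convex_sylvesterRanks S).sum_mem (fun j _ => rankCoord_nonneg h j)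
    (hf.sum_rankCoord h) fun j _ => hρ j) fun i => ?_
  rw [eltRank_sum]
  simp only [hρf]
  rw [hf.sum_rankCoord_mul h]

theorem sylvesterRanks_eq_convexHull (hf : IsSimpleModNilpotent f n)
    {ρ : Fin n → MatrixFunction S} (hρ : ∀ j, IsSylvesterRank (ρ j))
    (hρf : ∀ j, ∀ i : ℕ, eltRank (ρ j) (f ^ i) = max 0 (1 - (i : ℝ) / ((j : ℕ) + 1))) :
    sylvesterRanks S = convexHull ℝ (Set.range ρ) := by
  refine Set.Subset.antisymm (fun rk (h : IsSylvesterRank rk) => ?_)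
    (convexHull_min (Set.range_subset_iff.2 hρ) (convex_sylvesterRanks S))
  rw [hf.eq_sum_vertices hρ hρf h]
  exact (convex_convexHull ℝ _).sum_mem (fun j _ => rankCoord_nonneg h j) (hf.sum_rankCoord h)
    fun j _ => subset_convexHull ℝ _ ⟨j, rfl⟩

/-- Coordinates are affine and nonnegative. If a vertex is a proper convex combination, the
coordinates that vanish at the vertex vanish at both ends, so the ends equal the vertex. Coordinates
also separate the vertices. -/
theorem encard_extremePoints (hf : IsSimpleModNilpotent f n)
    {ρ : Fin n → MatrixFunction S} (hρ : ∀ j, IsSylvesterRank (ρ j))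
    (hρf : ∀ j, ∀ i : ℕ, eltRank (ρ j) (f ^ i) = max 0 (1 - (i : ℝ) / ((j : ℕ) + 1))) :
    (Set.extremePoints ℝ (sylvesterRanks S)).encard = n := by
  have hcoord : ∀ k j : Fin n, rankCoord f (ρ k) j = if j = k then 1 else 0 := fun k j => by
    rw [rankCoord_vertex (hρf k)]
    simp [Fin.ext_iff]
  have hinj : Function.Injective ρ := fun j k hjk => by
    have := hcoord j j
    rw [hjk, hcoord, if_pos rfl] at this
    by_contra hne
    rw [if_neg hne] at this
    exact zero_ne_one this
  have heq : Set.extremePoints ℝ (sylvesterRanks S) = Set.range ρ := by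
    refine Set.Subset.antisymm ?_ ?_
    · rw [hf.sylvesterRanks_eq_convexHull hρ hρf]
      exact extremePoints_convexHull_subset
    · rintro _ ⟨k, rfl⟩
      have key : ∀ x ∈ sylvesterRanks S, ∀ y ∈ sylvesterRanks S, ∀ a b : ℝ, 0 < a → 0 < b →
          a • x + b • y = ρ k → x = ρ k := by
        intro x (hx : IsSylvesterRank x) y (hy : IsSylvesterRank y) a b ha hb hxy
        have hz : ∀ j : Fin n, j ≠ k → rankCoord f x j = 0 := fun j hj => by
          have h1 := hcoord k j
          rw [← hxy, rankCoord_combo, if_neg hj] at h1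
          have h2 := mul_nonneg ha.le (rankCoord_nonneg (f := f) hx j)
          have h3 := mul_nonneg hb.le (rankCoord_nonneg (f := f) hy j)
          have h4 : a * rankCoord f x j = 0 := by linarith
          exact (mul_eq_zero.1 h4).resolve_left ha.ne'
        have h1 := hf.sum_rankCoord hx
        rw [Finset.sum_eq_single k (fun j _ hj => hz j hj) (by simp)] at h1
        rw [hf.eq_sum_vertices hρ hρf hx,
          Finset.sum_eq_single k (fun j _ hj => by rw [hz j hj, zero_smul]) (by simp), h1, one_smul]
      refine ⟨hρ k, fun x hx y hy ⟨a, b, ha, hb, _, hxy⟩ => ?_⟩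
      exact key x hx y hy a b ha hb hxy
  rw [heq, ← Set.image_univ, hinj.encard_image]
  simp

/-- Pullback preserves the values on corresponding powers, which determine rank functions on both
rings. For surjectivity, the coordinates of a rank function on `C` are used as weights for the
vertices on `S`. -/
theorem bijOn_pullback {C : Type*} [Ring C] {g : C} (hf : IsSimpleModNilpotent f n)
    (hg : IsSimpleModNilpotent g n) (φ : C →+* S) (hφ : φ g = f) {ρ : Fin n → MatrixFunction S}
    (hρ : ∀ j, IsSylvesterRank (ρ j))
    (hρf : ∀ j, ∀ i : ℕ, eltRank (ρ j) (f ^ i) = max 0 (1 - (i : ℝ) / ((j : ℕ) + 1))) :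
    Set.BijOn (pullback φ) (sylvesterRanks S) (sylvesterRanks C) := by
  have helt : ∀ (rk : MatrixFunction S) (i : ℕ),
      eltRank (pullback φ rk) (g ^ i) = eltRank rk (f ^ i) := fun rk i => by
    rw [eltRank_pullback, map_pow, hφ]
  refine ⟨fun rk h => IsSylvesterRank.pullback φ h, fun x hx y hy hxy => ?_,
    fun rk (h : IsSylvesterRank rk) => ?_⟩
  · exact hf.rank_ext hx hy fun i => by rw [← helt, ← helt, hxy]
  · have hS : ∑ j : Fin n, rankCoord g rk j • ρ j ∈ sylvesterRanks S :=
      (convex_sylvesterRanks S).sum_mem (fun j _ => rankCoord_nonneg h j)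
        (hg.sum_rankCoord h) fun j _ => hρ j
    refine ⟨_, hS, hg.rank_ext (IsSylvesterRank.pullback φ hS) h fun i => ?_⟩
    rw [helt, eltRank_sum]
    simp only [hρf]
    rw [hg.sum_rankCoord_mul h]

end IsSimpleModNilpotent

/-! ### Normalized dimension as a rank function on endomorphism rings. -/

namespace LinearMap

variable {E : Type*} [DivisionRing E] {M₁ M₂ N₁ N₂ : Type*} [AddCommGroup M₁] [AddCommGroup M₂]
  [AddCommGroup N₁] [AddCommGroup N₂] [Module E M₁] [Module E M₂] [Module E N₁] [Module E N₂]

theorem finrank_range_prodMap [FiniteDimensional E N₁] [FiniteDimensional E N₂]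
    (A : M₁ →ₗ[E] N₁) (B : M₂ →ₗ[E] N₂) :
    Module.finrank E (range (A.prodMap B)) =
      Module.finrank E (range A) + Module.finrank E (range B) := by
  rw [← Module.finrank_prod,
    ← finrank_range_of_inj (f := (range A).subtype.prodMap (range B).subtype)
      ((Submodule.subtype_injective _).prodMap (Submodule.subtype_injective _)),
    range_prodMap, range_prodMap, Submodule.range_subtype, Submodule.range_subtype]

/-- Project the range of the block map to the first factor: the image contains the range of `A`, and
the kernel contains a copy of the range of `B`. -/
theorem finrank_range_add_le_finrank_range_block [FiniteDimensional E N₁] [FiniteDimensional E N₂]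
    (A : M₁ →ₗ[E] N₁) (C : M₁ →ₗ[E] N₂) (B : M₂ →ₗ[E] N₂) :
    Module.finrank E (range A) + Module.finrank E (range B) ≤
      Module.finrank E (range ((A ∘ₗ fst E M₁ M₂).prod (C ∘ₗ fst E M₁ M₂ + B ∘ₗ snd E M₁ M₂))) := by
  set G := (A ∘ₗ fst E M₁ M₂).prod (C ∘ₗ fst E M₁ M₂ + B ∘ₗ snd E M₁ M₂) with hG
  set p : range G →ₗ[E] N₁ := fst E N₁ N₂ ∘ₗ (range G).subtype with hp
  have hA : range A ≤ range p := by
    rintro _ ⟨v, rfl⟩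
    exact ⟨⟨G (v, 0), mem_range_self _ _⟩, rfl⟩
  have hmem : ∀ x : range B, (inr E N₁ N₂ ∘ₗ (range B).subtype) x ∈ range G := by
    rintro ⟨_, w, rfl⟩
    exact ⟨(0, w), by simp [hG]⟩
  let j : range B →ₗ[E] ker p :=
    codRestrict (ker p) (codRestrict (range G) (inr E N₁ N₂ ∘ₗ (range B).subtype) hmem) fun x => by
      simp [hp]
  have hj : Function.Injective j := by
    intro x y hxy
    have := congrArg (fun z : ker p => z.1.1.2) hxy
    exact Subtype.ext this
  rw [← finrank_range_add_finrank_ker p]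
  exact Nat.add_le_add (Submodule.finrank_mono hA) (finrank_le_finrank_of_injective hj)

theorem finrank_range_equiv_comp_equiv (e : M₂ ≃ₗ[E] M₁) (g : M₁ →ₗ[E] N₁) (e' : N₁ ≃ₗ[E] N₂) :
    Module.finrank E (range (e'.toLinearMap ∘ₗ g ∘ₗ e.toLinearMap)) = Module.finrank E (range g) := by
  rw [range_comp, range_comp_of_range_eq_top _ e.range]
  exact LinearEquiv.finrank_map_eq e' _

theorem exists_comp_comp_eq_self (g : M₁ →ₗ[E] N₁) : ∃ h : N₁ →ₗ[E] M₁, g ∘ₗ h ∘ₗ g = g := by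
  obtain ⟨s, hs⟩ := g.rangeRestrict.exists_rightInverse_of_surjective (range_rangeRestrict g)
  obtain ⟨p, hp⟩ := (range g).subtype.exists_leftInverse_of_injective (Submodule.ker_subtype _)
  refine ⟨s ∘ₗ p, ext fun v => ?_⟩
  have h1 : p (g v) = g.rangeRestrict v := DFunLike.congr_fun hp (g.rangeRestrict v)
  have h2 : g (s (g.rangeRestrict v)) = g v :=
    congrArg Subtype.val (DFunLike.congr_fun hs (g.rangeRestrict v))
  rw [comp_apply, comp_apply, comp_apply, h1, h2]

end LinearMap

section EndRank

variable {E V : Type*} [DivisionRing E] [AddCommGroup V] [Module E V]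

theorem isVonNeumannRegular_end_mulOpposite (E V : Type*) [DivisionRing E] [AddCommGroup V]
    [Module E V] : IsVonNeumannRegular (Module.End E V)ᵐᵒᵖ := fun x => by
  obtain ⟨h, hh⟩ := x.unop.exists_comp_comp_eq_self
  exact ⟨MulOpposite.op h, MulOpposite.unop_injective hh⟩

/-- The action of a matrix over the opposite of an endomorphism ring on row vectors. -/
def rowMap {m n : ℕ} (X : Matrix (Fin m) (Fin n) (Module.End E V)ᵐᵒᵖ) :
    (Fin m → V) →ₗ[E] (Fin n → V) :=
  LinearMap.pi fun j => ∑ i, (X i j).unop ∘ₗ LinearMap.proj i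

theorem rowMap_apply {m n : ℕ} (X : Matrix (Fin m) (Fin n) (Module.End E V)ᵐᵒᵖ) (v : Fin m → V)
    (j : Fin n) : rowMap X v j = ∑ i, (X i j).unop (v i) := by
  simp [rowMap]

/-- Acting on row vectors reverses composition, which matches the multiplication in the opposite
ring. -/
theorem rowMap_mul {m n p : ℕ} (X : Matrix (Fin m) (Fin n) (Module.End E V)ᵐᵒᵖ)
    (Y : Matrix (Fin n) (Fin p) (Module.End E V)ᵐᵒᵖ) : rowMap (X * Y) = rowMap Y ∘ₗ rowMap X := by
  refine LinearMap.ext fun v => funext fun k => ?_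
  rw [rowMap_apply, LinearMap.comp_apply, rowMap_apply]
  simp only [rowMap_apply, Matrix.mul_apply, map_sum, Finset.unop_sum, MulOpposite.unop_mul,
    LinearMap.sum_apply, Module.End.mul_apply]
  exact Finset.sum_comm

/-- The decomposition of `V^{m+p}`. -/
def finAddArrowEquiv (E V : Type*) [DivisionRing E] [AddCommGroup V] [Module E V] (m p : ℕ) :
    (Fin (m + p) → V) ≃ₗ[E] (Fin m → V) × (Fin p → V) :=
  (LinearEquiv.funCongrLeft E V finSumFinEquiv).trans
    (LinearEquiv.sumArrowLequivProdArrow (Fin m) (Fin p) E V)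

theorem rowMap_upperBlock {m n p q : ℕ} (A : Matrix (Fin m) (Fin n) (Module.End E V)ᵐᵒᵖ)
    (C : Matrix (Fin m) (Fin q) (Module.End E V)ᵐᵒᵖ)
    (B : Matrix (Fin p) (Fin q) (Module.End E V)ᵐᵒᵖ) :
    rowMap (upperBlock A C B) = (finAddArrowEquiv E V n q).symm.toLinearMap ∘ₗ
      ((rowMap A ∘ₗ LinearMap.fst E _ _).prod
        (rowMap C ∘ₗ LinearMap.fst E _ _ + rowMap B ∘ₗ LinearMap.snd E _ _)) ∘ₗ
      (finAddArrowEquiv E V m p).toLinearMap := by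
  refine LinearMap.ext fun v => ?_
  rw [LinearMap.comp_apply, LinearEquiv.coe_coe, LinearEquiv.eq_symm_apply]
  refine Prod.ext (funext fun j => ?_) (funext fun j => ?_)
  · change rowMap _ v (finSumFinEquiv (Sum.inl j)) =
      rowMap A (fun i => v (finSumFinEquiv (Sum.inl i))) j
    rw [rowMap_apply, rowMap_apply, ← finSumFinEquiv.sum_comp, Fintype.sum_sum_type]
    simp [upperBlock]
  · change rowMap _ v (finSumFinEquiv (Sum.inr j)) =
      rowMap C (fun i => v (finSumFinEquiv (Sum.inl i))) j +
        rowMap B (fun i => v (finSumFinEquiv (Sum.inr i))) j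
    rw [rowMap_apply, rowMap_apply, rowMap_apply, ← finSumFinEquiv.sum_comp, Fintype.sum_sum_type]
    simp [upperBlock]

/-- The normalized rank on matrices over the opposite of the endomorphism ring of a vector space. -/
noncomputable def endRank (E V : Type*) [DivisionRing E] [AddCommGroup V] [Module E V] :
    MatrixFunction (Module.End E V)ᵐᵒᵖ :=
  fun _ _ X => (Module.finrank E (LinearMap.range (rowMap X)) : ℝ) / Module.finrank E V

theorem endRank_of (E V : Type*) [DivisionRing E] [AddCommGroup V] [Module E V]
    (g : Module.End E V) : eltRank (endRank E V) (MulOpposite.op g) =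
      (Module.finrank E (LinearMap.range g) : ℝ) / Module.finrank E V := by
  have h : rowMap (Matrix.of fun _ _ : Fin 1 => MulOpposite.op g) =
      (LinearEquiv.funUnique (Fin 1) E V).symm.toLinearMap ∘ₗ g ∘ₗ
        (LinearEquiv.funUnique (Fin 1) E V).toLinearMap := by
    refine LinearMap.ext fun v => funext fun j => ?_
    rw [rowMap_apply]
    simp
  rw [eltRank, endRank, h, LinearMap.finrank_range_equiv_comp_equiv]

theorem isSylvesterRank_endRank (E V : Type*) [DivisionRing E] [AddCommGroup V] [Module E V]
    [FiniteDimensional E V] [Nontrivial V] : IsSylvesterRank (endRank E V) := by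
  have hpos : (0 : ℝ) < Module.finrank E V := by exact_mod_cast Module.finrank_pos
  have hle : ∀ {a b : ℕ}, a ≤ b → (a : ℝ) / Module.finrank E V ≤ (b : ℝ) / Module.finrank E V :=
    fun h => by gcongr
  have hzero : ∀ m n : ℕ, rowMap (0 : Matrix (Fin m) (Fin n) (Module.End E V)ᵐᵒᵖ) = 0 :=
    fun m n => LinearMap.ext fun v => funext fun j => by rw [rowMap_apply]; simp
  refine
    { nonneg := fun m n X => by unfold endRank; positivity
      zero := fun m n => ?_
      one := ?_
      mul_le := fun m n p X Y => ?_
      diag := fun m n p q A B => ?_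
      upper := fun m n p q A C B => ?_ }
  · rw [endRank, hzero, LinearMap.range_zero, finrank_bot]; simp
  · have h := endRank_of E V 1
    rw [show LinearMap.range (1 : Module.End E V) = ⊤ from LinearMap.range_id, finrank_top,
      div_self hpos.ne'] at h
    rwa [show (1 : Matrix (Fin 1) (Fin 1) (Module.End E V)ᵐᵒᵖ) =
      Matrix.of fun _ _ => MulOpposite.op 1 by
        ext i j : 1; simp [Matrix.one_apply, Subsingleton.elim i j]]
  · refine le_min (hle ?_) (hle ?_)
    · rw [rowMap_mul, LinearMap.range_comp]
      exact Submodule.finrank_map_le _ _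
    · rw [rowMap_mul]
      exact Submodule.finrank_mono (LinearMap.range_comp_le_range _ _)
  · have h : (rowMap A ∘ₗ LinearMap.fst E _ _).prod
        (rowMap (0 : Matrix (Fin m) (Fin q) (Module.End E V)ᵐᵒᵖ) ∘ₗ LinearMap.fst E _ _ +
          rowMap B ∘ₗ LinearMap.snd E _ _) = (rowMap A).prodMap (rowMap B) := by
      rw [hzero, LinearMap.zero_comp, zero_add]
      rfl
    simp only [endRank]
    rw [rowMap_upperBlock, LinearMap.finrank_range_equiv_comp_equiv, ← add_div, ← Nat.cast_add,
      ← LinearMap.finrank_range_prodMap, h]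
  · simp only [endRank]
    rw [rowMap_upperBlock, LinearMap.finrank_range_equiv_comp_equiv, ← add_div, ← Nat.cast_add]
    exact hle (LinearMap.finrank_range_add_le_finrank_range_block _ _ _)

end EndRank

/-- The right regular representation of a ring that is an algebra (on the left) over `E`. -/
def rightRegular (E A : Type*) [DivisionRing E] [Ring A] [Module E A] [IsScalarTower E A A] :
    A →+* (Module.End E A)ᵐᵒᵖ where
  toFun a := MulOpposite.op
    { toFun := fun x => x * a
      map_add' := fun x y => add_mul x y a
      map_smul' := fun c x => smul_mul_assoc c x a }
  map_one' := MulOpposite.unop_injective (LinearMap.ext fun x => mul_one x)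
  map_mul' a b := MulOpposite.unop_injective (LinearMap.ext fun x => (mul_assoc x a b).symm)
  map_zero' := MulOpposite.unop_injective (LinearMap.ext fun x => mul_zero x)
  map_add' a b := MulOpposite.unop_injective (LinearMap.ext fun x => mul_add x a b)

/-- If a ring `S` maps to a ring `A` that is finite-dimensional over a division ring `E`, then `S`
has a regular rank function given by normalized dimensions of left ideals of `A`. -/
theorem exists_mem_regularRanks.{u} {S A E : Type u} [Ring S] [Ring A] [DivisionRing E] [Module E A]
    [IsScalarTower E A A] [FiniteDimensional E A] [Nontrivial A] (φ : S →+* A) :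
    ∃ rk ∈ regularRanks S, ∀ s, eltRank rk s =
      (Module.finrank E (LinearMap.range (rightRegular E A (φ s)).unop) : ℝ) / Module.finrank E A :=
  have h : pullback ((rightRegular E A).comp φ) (endRank E A) ∈ regularRanks S :=
    ⟨(Module.End E A)ᵐᵒᵖ, inferInstance, (rightRegular E A).comp φ, endRank E A,
      isVonNeumannRegular_end_mulOpposite E A, isSylvesterRank_endRank E A, rfl⟩
  ⟨_, h, fun s => endRank_of E A (rightRegular E A (φ s)).unop⟩

theorem LinearMap.finrank_range_eq_of_ker_eq {E M N N' : Type*} [DivisionRing E] [AddCommGroup M]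
    [AddCommGroup N] [AddCommGroup N'] [Module E M] [Module E N] [Module E N'] {p : M →ₗ[E] N}
    {q : M →ₗ[E] N'} (h : ker p = ker q) :
    Module.finrank E (range p) = Module.finrank E (range q) :=
  (p.quotKerEquivRange.symm.trans
    ((Submodule.quotEquivOfEq _ _ h).trans q.quotKerEquivRange)).finrank_eq

/-! ### Quotients by powers of a centrally generated ideal. -/

section PowerQuotient

variable {E R : Type*} [DivisionRing E] [Ring R] [Module E R] [IsScalarTower E R R]

/-- The quotient map by a left ideal as a map of vector spaces. -/
def quotientLinearMap (E : Type*) {R : Type*} [DivisionRing E] [Ring R] [Module E R]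
    [IsScalarTower E R R] (I : Ideal R) [I.IsTwoSided] : R →ₗ[E] R ⧸ I where
  toFun := Ideal.Quotient.mk I
  map_add' := map_add _
  map_smul' _ _ := rfl

theorem quotientLinearMap_surjective (I : Ideal R) [I.IsTwoSided] :
    Function.Surjective (quotientLinearMap E I) := Ideal.Quotient.mk_surjective

instance (I : Ideal R) [I.IsTwoSided] : IsScalarTower E (R ⧸ I) (R ⧸ I) where
  smul_assoc c x y := by
    obtain ⟨x, rfl⟩ := Ideal.Quotient.mk_surjective x
    obtain ⟨y, rfl⟩ := Ideal.Quotient.mk_surjective y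
    change Ideal.Quotient.mk I (c • x) * Ideal.Quotient.mk I y =
      c • Ideal.Quotient.mk I (x * y)
    rw [← map_mul, smul_mul_assoc]
    rfl

/-- `I` is a proper two-sided ideal generated by a regular central element `f`. -/
structure IsCentralGenerator (I : Ideal R) (f : R) : Prop where
  commute : ∀ x, Commute f x
  regular : ∀ x, x * f = 0 → x = 0
  ne_top : I ≠ ⊤
  mem_iff : ∀ x, x ∈ I ↔ ∃ g, x = g * f

namespace IsCentralGenerator

variable {I : Ideal R} {f : R}

theorem regular_pow (hf : IsCentralGenerator I f) (k : ℕ) {x : R} (h : x * f ^ k = 0) : x = 0 := by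
  induction k with
  | zero => simpa using h
  | succ k ih =>
    rw [pow_succ, ← mul_assoc] at h
    exact ih (hf.regular _ h)

variable [I.IsTwoSided]

theorem mem_pow_iff (hf : IsCentralGenerator I f) (k : ℕ) (x : R) :
    x ∈ I ^ k ↔ ∃ g, x = g * f ^ k := by
  have hI : I = Ideal.span {f} := Ideal.ext fun y => by
    rw [hf.mem_iff, Ideal.mem_span_singleton']
    exact ⟨fun ⟨g, h⟩ => ⟨g, h.symm⟩, fun ⟨g, h⟩ => ⟨g, h.symm⟩⟩
  subst hI
  rw [Ideal.span_singleton_pow, Ideal.mem_span_singleton']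
  exact ⟨fun ⟨g, h⟩ => ⟨g, h.symm⟩, fun ⟨g, h⟩ => ⟨g, h.symm⟩⟩

theorem pow_le_pow (hf : IsCentralGenerator I f) {j n : ℕ} (h : j ≤ n) : I ^ n ≤ I ^ j := by
  intro x hx
  obtain ⟨g, rfl⟩ := (hf.mem_pow_iff n x).1 hx
  rw [← Nat.sub_add_cancel h, pow_add, ← mul_assoc]
  exact (hf.mem_pow_iff j _).2 ⟨_, rfl⟩

theorem pow_le_self (hf : IsCentralGenerator I f) {n : ℕ} (h : 1 ≤ n) : I ^ n ≤ I := by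
  intro x hx
  obtain ⟨g, rfl⟩ := (hf.mem_pow_iff n x).1 hx
  rw [← Nat.sub_add_cancel h, pow_succ, ← mul_assoc]
  exact (hf.mem_iff _).2 ⟨_, rfl⟩

/-- By regularity of `f`, the kernel of `x ↦ x f^i` from `R` to `R ⧸ I ^ j` is `I ^ (j - i)`. -/
theorem finrank_range_rightRegular (hf : IsCentralGenerator I f) {i j : ℕ} (hij : i ≤ j) :
    Module.finrank E (LinearMap.range
      (rightRegular E (R ⧸ I ^ j) (Ideal.Quotient.mk (I ^ j) (f ^ i))).unop) =
      Module.finrank E (R ⧸ I ^ (j - i)) := by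
  set g := (rightRegular E (R ⧸ I ^ j) (Ideal.Quotient.mk (I ^ j) (f ^ i))).unop with hg
  rw [← LinearMap.range_comp_of_range_eq_top g
    (LinearMap.range_eq_top.2 (quotientLinearMap_surjective (E := E) (I ^ j))),
    LinearMap.finrank_range_eq_of_ker_eq (q := quotientLinearMap E (I ^ (j - i))) ?_,
    LinearMap.range_eq_top.2 (quotientLinearMap_surjective _), finrank_top]
  ext x
  rw [LinearMap.mem_ker, LinearMap.mem_ker]
  change Ideal.Quotient.mk (I ^ j) x * Ideal.Quotient.mk (I ^ j) (f ^ i) = 0 ↔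
    Ideal.Quotient.mk (I ^ (j - i)) x = 0
  rw [← map_mul, Ideal.Quotient.eq_zero_iff_mem, Ideal.Quotient.eq_zero_iff_mem, hf.mem_pow_iff,
    hf.mem_pow_iff]
  constructor
  · rintro ⟨y, hy⟩
    refine ⟨y, sub_eq_zero.1 (hf.regular_pow i ?_)⟩
    rw [sub_mul, hy, mul_assoc, ← pow_add, Nat.sub_add_cancel hij, sub_self]
  · rintro ⟨y, rfl⟩
    exact ⟨y, by rw [mul_assoc, ← pow_add, Nat.sub_add_cancel hij]⟩

variable [∀ k, FiniteDimensional E (R ⧸ I ^ k)]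

/-- The kernel of `R ⧸ I ^ (j + 1) → R ⧸ I ^ 1` is the image of multiplication by `f`, which has the
dimension of `R ⧸ I ^ j`. -/
theorem finrank_quotient_pow (hf : IsCentralGenerator I f) (j : ℕ) :
    Module.finrank E (R ⧸ I ^ j) = j * Module.finrank E (R ⧸ I ^ 1) := by
  induction j with
  | zero =>
    have : Subsingleton (R ⧸ I ^ 0) := Ideal.Quotient.subsingleton_iff.2
      (eq_top_iff.2 fun x _ => (hf.mem_pow_iff 0 x).2 ⟨x, by simp⟩)
    rw [Module.finrank_zero_of_subsingleton, zero_mul]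
  | succ j ih =>
    let q : (R ⧸ I ^ (j + 1)) →ₗ[E] R ⧸ I ^ 1 :=
      { toFun := Ideal.Quotient.factor (hf.pow_le_pow (by omega))
        map_add' := map_add _
        map_smul' := fun c x => by
          obtain ⟨x, rfl⟩ := Ideal.Quotient.mk_surjective x
          rfl }
    have hq : ∀ x, q (Ideal.Quotient.mk _ x) = Ideal.Quotient.mk _ x := fun _ => rfl
    have hsurj : Function.Surjective q := fun y => by
      obtain ⟨y, rfl⟩ := Ideal.Quotient.mk_surjective y
      exact ⟨Ideal.Quotient.mk _ y, hq y⟩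
    have hker : LinearMap.ker q = LinearMap.range
        (rightRegular E (R ⧸ I ^ (j + 1)) (Ideal.Quotient.mk (I ^ (j + 1)) (f ^ 1))).unop := by
      ext x
      obtain ⟨x, rfl⟩ := Ideal.Quotient.mk_surjective x
      rw [LinearMap.mem_ker, hq, Ideal.Quotient.eq_zero_iff_mem, hf.mem_pow_iff]
      constructor
      · rintro ⟨g, rfl⟩
        exact ⟨Ideal.Quotient.mk _ g, (map_mul _ _ _).symm⟩
      · rintro ⟨y, hy⟩
        obtain ⟨y, rfl⟩ := Ideal.Quotient.mk_surjective y
        have hy : Ideal.Quotient.mk (I ^ (j + 1)) y * Ideal.Quotient.mk (I ^ (j + 1)) (f ^ 1) =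
          Ideal.Quotient.mk (I ^ (j + 1)) x := hy
        rw [← map_mul, Ideal.Quotient.eq, hf.mem_pow_iff] at hy
        obtain ⟨g, hg⟩ := hy
        exact ⟨y - g * f ^ j, by rw [sub_mul, mul_assoc, ← pow_add, ← hg]; abel⟩
    have := LinearMap.finrank_range_add_finrank_ker q
    rw [hker, hf.finrank_range_rightRegular (by omega), LinearMap.range_eq_top.2 hsurj, finrank_top,
      Nat.add_sub_cancel, ih] at this
    rw [← this]
    ring

theorem finrank_quotient_pos (hf : IsCentralGenerator I f) :
    0 < Module.finrank E (R ⧸ I ^ 1) := by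
  have : Nontrivial (R ⧸ I ^ 1) := Ideal.Quotient.nontrivial_iff.2 fun h => hf.ne_top <|
    eq_top_iff.2 (h ▸ hf.pow_le_self le_rfl)
  exact Module.finrank_pos

end IsCentralGenerator

/-- The vertices of the simplex of rank functions on `R ⧸ I ^ n`. -/
theorem IsCentralGenerator.exists_vertex.{u} {E R : Type u} [DivisionRing E] [Ring R] [Module E R]
    [IsScalarTower E R R] {I : Ideal R} {f : R} [I.IsTwoSided]
    [∀ k, FiniteDimensional E (R ⧸ I ^ k)] (hf : IsCentralGenerator I f) {n j : ℕ} (hj : j < n) :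
    ∃ ρ ∈ regularRanks (R ⧸ I ^ n), ∀ i : ℕ, eltRank ρ (Ideal.Quotient.mk (I ^ n) f ^ i) =
      max 0 (1 - (i : ℝ) / (j + 1)) := by
  have hq := hf.finrank_quotient_pos (E := E)
  have hpos : 0 < Module.finrank E (R ⧸ I ^ (j + 1)) := by
    rw [hf.finrank_quotient_pow]
    positivity
  have : Nontrivial (R ⧸ I ^ (j + 1)) := Module.nontrivial_of_finrank_pos hpos
  obtain ⟨ρ, hρ, h⟩ := exists_mem_regularRanks (E := E)
    (Ideal.Quotient.factor (hf.pow_le_pow (Nat.succ_le_of_lt hj)) : R ⧸ I ^ n →+* R ⧸ I ^ (j + 1))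
  refine ⟨ρ, hρ, fun i => ?_⟩
  rw [h, ← map_pow, Ideal.Quotient.factor_mk]
  have hj1 : (0 : ℝ) < j + 1 := by positivity
  -- For `i ≤ j + 1` the ratio of dimensions is `(j + 1 - i)/(j + 1)`; beyond that `f ^ i` is zero
  -- in `R ⧸ I ^ (j + 1)`.
  rcases le_total i (j + 1) with hi | hi
  · rw [hf.finrank_range_rightRegular hi, hf.finrank_quotient_pow, hf.finrank_quotient_pow (j + 1),
      max_eq_right]
    · push_cast [Nat.cast_sub hi]
      field_simp
    · rw [sub_nonneg, div_le_one hj1]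
      exact_mod_cast hi
  · rw [Ideal.Quotient.eq_zero_iff_mem.2 ((hf.mem_pow_iff (j + 1) _).2
      ⟨f ^ (i - (j + 1)), by rw [← pow_add, Nat.sub_add_cancel hi]⟩), map_zero, MulOpposite.unop_zero,
      LinearMap.range_zero, finrank_bot, max_eq_left]
    · simp
    · rw [sub_nonpos, one_le_div hj1]
      exact_mod_cast hi

theorem IsSimpleModNilpotent.of_isSimpleRing.{u} {S Q : Type u} [Ring S] [Ring Q] [IsSimpleRing Q]
    [IsArtinianRing Q] {f : S} {n : ℕ} (hc : ∀ x, Commute f x) (hn : f ^ n = 0) (p : S →+* Q)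
    (hp : Function.Surjective p) (hker : ∀ x, p x = 0 → ∃ y, x = f * y) :
    IsSimpleModNilpotent f n := by
  obtain ⟨r, hr, E, _, ⟨e⟩⟩ := IsSimpleRing.exists_ringEquiv_matrix_divisionRing Q
  refine ⟨hc, hn, E, inferInstance, r, e.toRingHom.comp p, Nat.pos_of_ne_zero hr.out,
    e.surjective.comp hp, fun x hx => hker x ?_⟩
  exact e.injective (by simpa using hx)

end PowerQuotient

/-! ### The skew Laurent quotient and the quotient of its centre. -/

namespace SkewLaurent

variable {D : Type*} [DivisionRing D] {τ : RingAut D}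

noncomputable instance : Module D (SkewLaurent τ) := Module.compHom _ (C τ)

theorem smul_eq_C_mul (a : D) (x : SkewLaurent τ) : a • x = C τ a * x := rfl

instance : IsScalarTower D (SkewLaurent τ) (SkewLaurent τ) where
  smul_assoc a x y := mul_assoc (C τ a) x y

/-- Remainders on division by the generator are spanned by `1, t, …, t^(s-1)`. -/
theorem finiteDimensional_quotient (I : Ideal (SkewLaurent τ)) [I.IsTwoSided] (hI : I ≠ ⊥) :
    FiniteDimensional D (SkewLaurent τ ⧸ I) := by
  obtain ⟨s, f, hf⟩ := exists_isMinimalGenerator I hI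
  refine Module.Finite.of_surjective (Fintype.linearCombination D
    fun i : Fin s => quotientLinearMap D I (mono τ i 1)) fun x => ?_
  obtain ⟨x, rfl⟩ := quotientLinearMap_surjective (E := D) I x
  obtain ⟨y, hy, h⟩ := hf.exists_sub_mem x
  refine ⟨fun i => coeff y i, ?_⟩
  rw [Fintype.linearCombination_apply]
  simp only [← map_smul, ← map_sum]
  refine (Ideal.Quotient.eq.2 ?_).symm
  convert! h using 2
  simp only [smul_eq_C_mul, ← mono_eq_C_mul]
  refine ext fun k => ?_
  simp only [coeff_sum, coeff_mono]
  by_cases hk : coeff y k = 0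
  · rw [hk]
    refine Finset.sum_eq_zero fun i _ => ?_
    split_ifs with h
    · rw [h, hk]
    · rfl
  · obtain ⟨h0, h1⟩ := hy k hk
    lift k to ℕ using h0
    rw [Finset.sum_eq_single (⟨k, by omega⟩ : Fin s)]
    · simp
    · rintro ⟨i, hi⟩ _ hne
      refine if_neg fun h => hne ?_
      simpa using h
    · simp

theorem IsMinimalGenerator.isCentralGenerator {I : Ideal (SkewLaurent τ)} [I.IsTwoSided] {s : ℕ}
    {f : SkewLaurent τ} (hf : IsMinimalGenerator I s f) (hI : I ≠ ⊤) : IsCentralGenerator I f where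
  commute x := ((Subring.mem_center_iff.1 hf.mem_center) x).symm
  regular _ h := hf.mul_eq_zero_iff h
  ne_top := hI
  mem_iff := hf.mem_iff

/-- A central `z` outside `m` has an inverse modulo `m`. This inverse commutes with everything
modulo `m`, so it can be replaced by a central element. -/
theorem IsMinimalGenerator.isMaximal_comap_center {m : TwoSidedIdeal (SkewLaurent τ)} {s : ℕ}
    {f : SkewLaurent τ} (hf : IsMinimalGenerator m.asIdeal s f) (hm : IsCoatom m) :
    (m.asIdeal.comap (Subring.center (SkewLaurent τ)).subtype).IsMaximal := by
  rw [Ideal.isMaximal_iff]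
  refine ⟨fun h => hm.1 (eq_top_iff.2 fun x _ => ?_), fun J z hJ hz hzJ => ?_⟩
  · have h1 : (1 : SkewLaurent τ) ∈ m := TwoSidedIdeal.mem_asIdeal.1 (Ideal.mem_comap.1 h)
    simpa using m.mul_mem_left x _ h1
  · obtain ⟨z, hzc⟩ := z
    have hzm : z ∉ m := fun h => hz (Ideal.mem_comap.2 (TwoSidedIdeal.mem_asIdeal.2 h))
    obtain ⟨y, hy⟩ := hm.exists_mul_sub_one_mem hzc hzm
    have hzy := TwoSidedIdeal.mem_asIdeal.2 hy
    have hcomm := Subring.mem_center_iff.1 hzc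
    have hyc : ∀ g, g * y - y * g ∈ m.asIdeal := by
      intro g
      have : g * y - y * g = y * g * (z * y - 1) - (z * y - 1) * (g * y) := by
        have h1 : y * g * (z * y) = z * y * (g * y) := by
          rw [← mul_assoc (y * g), hcomm (y * g)]
          simp only [mul_assoc]
        rw [mul_sub, sub_mul, h1]; simp
      rw [this]
      exact m.asIdeal.sub_mem (m.asIdeal.mul_mem_left _ hzy) (m.asIdeal.mul_mem_right _ hzy)
    obtain ⟨y', hy', hyy'⟩ := hf.exists_center_sub_mem hyc
    have hmem : (⟨z, hzc⟩ * ⟨y', hy'⟩ - 1 : Subring.center (SkewLaurent τ)) ∈ J := by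
      refine hJ (Ideal.mem_comap.2 ?_)
      have : z * y' - 1 ∈ m.asIdeal := by
        have h2 : z * y' - 1 = (z * y - 1) - z * (y - y') := by rw [mul_sub]; abel
        rw [h2]
        exact m.asIdeal.sub_mem hzy (m.asIdeal.mul_mem_left _ hyy')
      exact this
    have h1 := J.sub_mem (J.mul_mem_right ⟨y', hy'⟩ hzJ) hmem
    rwa [sub_sub_cancel] at h1

theorem isSimpleModNilpotent_quotient {m : TwoSidedIdeal (SkewLaurent τ)} (hm : IsCoatom m)
    (hbot : m.asIdeal ≠ ⊥) {f : SkewLaurent τ} (hf : IsCentralGenerator m.asIdeal f) {n : ℕ}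
    (hn : 1 ≤ n) : IsSimpleModNilpotent (Ideal.Quotient.mk (m.asIdeal ^ n) f) n := by
  have : IsSimpleRing (SkewLaurent τ ⧸ m.asIdeal) := hm.isSimpleRing_quotient
  have := finiteDimensional_quotient m.asIdeal hbot
  have : IsArtinianRing (SkewLaurent τ ⧸ m.asIdeal) := isArtinian_of_tower D inferInstance
  refine .of_isSimpleRing (fun x => ?_) ?_ (Ideal.Quotient.factor (hf.pow_le_self hn))
    (Ideal.Quotient.factor_surjective _) fun x hx => ?_
  · obtain ⟨x, rfl⟩ := Ideal.Quotient.mk_surjective x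
    exact (hf.commute x).map _
  · rw [← map_pow, Ideal.Quotient.eq_zero_iff_mem, hf.mem_pow_iff]
    exact ⟨1, by simp⟩
  · obtain ⟨x, rfl⟩ := Ideal.Quotient.mk_surjective x
    rw [Ideal.Quotient.factor_mk, Ideal.Quotient.eq_zero_iff_mem, hf.mem_iff] at hx
    obtain ⟨g, rfl⟩ := hx
    exact ⟨Ideal.Quotient.mk _ g, by rw [← map_mul, (hf.commute g).eq]⟩

/-- The kernel condition needs `I ∩ Z(R) = f Z(R)`: if `g * f` is central, regularity of `f` makes
`g` central. -/
theorem isSimpleModNilpotent_center_quotient {I : Ideal (SkewLaurent τ)} [I.IsTwoSided]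
    {f : SkewLaurent τ} (hf : IsCentralGenerator I f)
    (hmax : (I.comap (Subring.center (SkewLaurent τ)).subtype).IsMaximal)
    (hfc : f ∈ Subring.center (SkewLaurent τ)) {n : ℕ} (hn : 1 ≤ n) :
    IsSimpleModNilpotent
      (Ideal.Quotient.mk ((I ^ n).comap (Subring.center (SkewLaurent τ)).subtype) ⟨f, hfc⟩) n := by
  have hle : (I ^ n).comap (Subring.center (SkewLaurent τ)).subtype ≤
    I.comap (Subring.center (SkewLaurent τ)).subtype := Ideal.comap_mono (hf.pow_le_self hn)
  let := Ideal.Quotient.field (I.comap (Subring.center (SkewLaurent τ)).subtype)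
  have hS : IsSimpleRing (Subring.center (SkewLaurent τ) ⧸
    I.comap (Subring.center (SkewLaurent τ)).subtype) := inferInstance
  have hA : IsArtinianRing (Subring.center (SkewLaurent τ) ⧸
    I.comap (Subring.center (SkewLaurent τ)).subtype) := inferInstance
  refine .of_isSimpleRing (fun x => Commute.all _ _) ?_ (Ideal.Quotient.factor hle)
    (Ideal.Quotient.factor_surjective _) fun x hx => ?_
  · rw [← map_pow, Ideal.Quotient.eq_zero_iff_mem, Ideal.mem_comap, map_pow]
    exact (hf.mem_pow_iff n _).2 ⟨1, by simp⟩
  · obtain ⟨⟨x, hxc⟩, rfl⟩ := Ideal.Quotient.mk_surjective x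
    rw [Ideal.Quotient.factor_mk, Ideal.Quotient.eq_zero_iff_mem, Ideal.mem_comap] at hx
    obtain ⟨g, hg⟩ := (hf.mem_iff _).1 hx
    change x = g * f at hg
    subst hg
    have hgc : g ∈ Subring.center (SkewLaurent τ) := by
      rw [Subring.mem_center_iff] at hxc ⊢
      intro a
      refine sub_eq_zero.1 (hf.regular _ ?_)
      rw [sub_mul, mul_assoc, hxc, mul_assoc, mul_assoc, (hf.commute a).eq, sub_self]
    refine ⟨Ideal.Quotient.mk _ ⟨g, hgc⟩, ?_⟩
    rw [← map_mul]
    congr 1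
    exact Subtype.ext (hf.commute g).eq.symm

end SkewLaurent

open SkewLaurent in
theorem mainTheorem7 {D : Type*} [DivisionRing D] (τ : RingAut D) (hτ : HasFiniteInnerOrder τ)
    (m : TwoSidedIdeal (SkewLaurent τ)) (hm : IsCoatom m) (n : ℕ) (hn : 1 ≤ n) :
    (Set.extremePoints ℝ (sylvesterRanks (SkewLaurent τ ⧸ m.asIdeal ^ n))).encard = n ∧
    sylvesterRanks (SkewLaurent τ ⧸ m.asIdeal ^ n) =
      regularRanks (SkewLaurent τ ⧸ m.asIdeal ^ n) ∧
    Function.Injective (centerQuotientMap (m.asIdeal ^ n)) ∧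
    Set.BijOn (pullback (centerQuotientMap (m.asIdeal ^ n)))
      (sylvesterRanks (SkewLaurent τ ⧸ m.asIdeal ^ n))
      (sylvesterRanks (Subring.center (SkewLaurent τ) ⧸
        (m.asIdeal ^ n).comap (Subring.center (SkewLaurent τ)).subtype)) := by
  have hbot := asIdeal_ne_bot hτ hm
  obtain ⟨s, f, hfm⟩ := exists_isMinimalGenerator m.asIdeal hbot
  have htop : m.asIdeal ≠ ⊤ := fun h => hm.1 (eq_top_iff.2 fun x _ => by
    rw [← TwoSidedIdeal.mem_asIdeal, h]
    trivial)
  have hf := hfm.isCentralGenerator htop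
  -- Powers of the ideal are nonzero since they contain `f ^ k`, which is regular.
  have hfin : ∀ k, FiniteDimensional D (SkewLaurent τ ⧸ m.asIdeal ^ k) := fun k =>
    finiteDimensional_quotient _ fun h => by
      have h1 : f ^ k ∈ m.asIdeal ^ k := (hf.mem_pow_iff k _).2 ⟨1, by simp⟩
      rw [h, Ideal.mem_bot] at h1
      have h2 : (1 : SkewLaurent τ) = 0 := hf.regular_pow k (by rw [h1, mul_zero])
      exact htop ((Ideal.eq_top_iff_one _).2 (h2 ▸ m.asIdeal.zero_mem))
  have hS := isSimpleModNilpotent_quotient hm hbot hf hn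
  have hC := isSimpleModNilpotent_center_quotient hf (hfm.isMaximal_comap_center hm) hfm.mem_center hn
  choose ρ hreg hρf using fun j : Fin n => hf.exists_vertex (E := D) j.2
  have hρ : ∀ j, IsSylvesterRank (ρ j) := fun j => regularRanks_subset _ (hreg j)
  refine ⟨hS.encard_extremePoints hρ hρf, ?_, Ideal.quotientMap_injective,
    hS.bijOn_pullback hC _ rfl hρ hρf⟩
  -- The vertices are regular, and a convex set containing them contains their hull.
  refine Set.Subset.antisymm ?_ (regularRanks_subset _)
  rw [hS.sylvesterRanks_eq_convexHull hρ hρf]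
  exact convexHull_min (Set.range_subset_iff.2 hreg) (convex_regularRanks _)
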